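/- A \emph{triple} $(V,T,U)$ consists of a finite-dimensional complex vector space $V$, a nilpotent linear operator $T$ on $V$ and a $T$-invariant subspace $U\subseteq V$. It is \emph{indecomposable} if, for all $T$-invariant subspaces $V',V''$ of $V$ with $V=V'\oplus V''$ and $U=(U\cap V')\oplus(U\cap V'')$, one has $V'=\{0\}$ or $V''=\{0\}$. Let $p\ge 1$ be the order of nilpotency of $T$ ($T^p=0$, $T^{p-1}\neq 0$), and put $n_V=\dim\ker T$ and $n_U=\dim\ker(T|_U)$. Triples $(V,T,U)$ and $(V',T',U')$ are \emph{similar} if there is a linear isomorphism $f:V\to V'$ with $f(U)=U'$ and $fT=T'f$. Theorem. (1) If $(V,T,U)$ is an indecomposable triple with $p\le 5$, $n_V=3$ and $n_U=2$, then $p=5$. In particular, for $p\le 4$ there is no indecomposable triple with $n_V=3$ and $n_U=2$. (2) Up to similarity there are exactly $8$ indecomposable triples with $p=5$, $n_V=3$, $n_U=2$. For natural numbers $(v_1,v_2,v_3)$ let $V$ be the space with basis $\{T^ja_i : 1\le i\le 3,\ 0\le j\le v_i\}$, where $T$ acts by $T(T^ja_i)=T^{j+1}a_i$ and $T^{v_i+1}a_i=0$,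 and let $U$ be the smallest $T$-invariant subspace containing two vectors $y,y'$. The following eight choices give triples which are indecomposable with $p=5$, $n_V=3$, $n_U=2$ and pairwise non-similar, and every indecomposable triple with $p=5$, $n_V=3$, $n_U=2$ is similar to exactly one of them: 1. $(v_1,v_2,v_3)=(0,2,4)$, $y=T^2a_2$, $y'=T^2a_3+Ta_2+a_1$; 2. $(v_1,v_2,v_3)=(1,2,4)$, $y=Ta_2$, $y'=Ta_3+a_2+a_1$; 3. $(v_1,v_2,v_3)=(1,2,4)$, $y=Ta_1$, $y'=T^2a_3+Ta_2+a_1$; 4. $(v_1,v_2,v_3)=(0,2,4)$, $y=a_1+Ta_2$, $y'=T^2a_3+a_1$; 5. $(v_1,v_2,v_3)=(1,3,4)$, $y=Ta_1+T^2a_2$, $y'=Ta_3+a_1$; 6. $(v_1,v_2,v_3)=(1,4,4)$, $y=Ta_1+T^3a_2$, $y'=Ta_3+a_1$; 7. $(v_1,v_2,v_3)=(1,3,4)$, $y=a_1+Ta_2$, $y'=T^3a_3+Ta_1$; 8. $(v_1,v_2,v_3)=(0,2,4)$, $y=a_1+Ta_2$, $y'=Ta_3+a_2$. -/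

import Mathlib

universe u v w

/-- A triple `(V, T, U)`: a finite dimensional complex vector space `V`, a linear operator `T`
on `V`, and a `T`-invariant subspace `U` of `V`. -/
structure InvTriple where
  /-- the underlying space -/
  V : Type u
  [instAddCommGroup : AddCommGroup V]
  [instModule : Module ℂ V]
  [instFiniteDimensional : FiniteDimensional ℂ V]
  /-- the operator -/
  T : V →ₗ[ℂ] V
  /-- the invariant subspace -/
  U : Submodule ℂ V
  invariant : ∀ x ∈ U, T x ∈ U

namespace InvTriple

attribute [instance] instAddCommGroup instModule instFiniteDimensional

/-- `T` is nilpotent of order `p ≥ 1`: `T ^ p = 0` and `T ^ (p - 1) ≠ 0`. -/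
def NilpotentOfOrder (A : InvTriple.{u}) (p : ℕ) : Prop :=
  1 ≤ p ∧ A.T ^ p = 0 ∧ A.T ^ (p - 1) ≠ 0

/-- `n_V`, the dimension of `[V] = ker T`. -/
noncomputable def nV (A : InvTriple.{u}) : ℕ :=
  Module.finrank ℂ (LinearMap.ker A.T)

/-- `n_U`, the dimension of `[U] = ker (T|_U)`. -/
noncomputable def nU (A : InvTriple.{u}) : ℕ :=
  Module.finrank ℂ (LinearMap.ker (A.T.domRestrict A.U))

/-- Indecomposability: whenever `V = V' ⊕ V''` with `V'`, `V''` invariant under `T` and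
`U = (U ∩ V') ⊕ (U ∩ V'')`, one of `V'`, `V''` is zero. (The second sum is automatically direct
once the first one is.) -/
def Indecomposable (A : InvTriple.{u}) : Prop :=
  ∀ V' V'' : Submodule ℂ A.V,
    (∀ x ∈ V', A.T x ∈ V') → (∀ x ∈ V'', A.T x ∈ V'') →
    IsCompl V' V'' → A.U = (A.U ⊓ V') ⊔ (A.U ⊓ V'') →
    V' = ⊥ ∨ V'' = ⊥

/-- Similarity of triples: a linear isomorphism `f : V → V'` with `f(U) = U'` and `f T = T' f`. -/
def Similar (A : InvTriple.{u}) (B : InvTriple.{v}) : Prop :=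
  ∃ f : A.V ≃ₗ[ℂ] B.V,
    A.U.map (f : A.V →ₗ[ℂ] B.V) = B.U ∧ ∀ x, f (A.T x) = B.T (f x)

theorem Similar.refl (A : InvTriple.{u}) : Similar A A :=
  ⟨LinearEquiv.refl ℂ A.V, by simp, fun _ => rfl⟩

theorem Similar.symm {A : InvTriple.{u}} {B : InvTriple.{v}} (h : Similar A B) :
    Similar B A := by
  obtain ⟨f, hU, hT⟩ := h
  refine ⟨f.symm, ?_, fun x => ?_⟩
  · rw [← hU, ← Submodule.map_comp]
    simp
  · rw [LinearEquiv.symm_apply_eq, hT, LinearEquiv.apply_symm_apply]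

theorem Similar.trans {A : InvTriple.{u}} {B : InvTriple.{v}} {C : InvTriple.{w}}
    (h : Similar A B) (h' : Similar B C) : Similar A C := by
  obtain ⟨f, hU, hT⟩ := h
  obtain ⟨g, hU', hT'⟩ := h'
  refine ⟨f.trans g, ?_, fun x => ?_⟩
  · rw [← hU', ← hU, ← Submodule.map_comp]
    rfl
  · simp [hT, hT']

/-- The indecomposable triples with `o(T) = p`, `n_V = m` and `n_U = k`. -/
abbrev Indec (p m k : ℕ) : Type (u + 1) :=
  {A : InvTriple.{u} //
    A.NilpotentOfOrder p ∧ A.Indecomposable ∧ A.nV = m ∧ A.nU = k}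

/-- Similarity, as an equivalence relation on `Indec p m k`. -/
def indecSetoid (p m k : ℕ) : Setoid (Indec.{u} p m k) where
  r A B := Similar A.1 B.1
  iseqv := ⟨fun A => Similar.refl A.1, Similar.symm, Similar.trans⟩

end InvTriple

/-- `vect_T(S)`, the smallest `T`-invariant subspace containing `S`. -/
def vectT {V : Type u} [AddCommGroup V] [Module ℂ V] (T : V →ₗ[ℂ] V) (S : Set V) :
    Submodule ℂ V :=
  Submodule.span ℂ {z | ∃ x ∈ S, ∃ k : ℕ, z = (T ^ k) x}

theorem vectT_invariant {V : Type u} [AddCommGroup V] [Module ℂ V] (T : V →ₗ[ℂ] V) (S : Set V) :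
    ∀ x ∈ vectT T S, T x ∈ vectT T S := by
  intro x hx
  refine Submodule.span_induction ?_ ?_ ?_ ?_ hx
  · rintro z ⟨y, hy, k, rfl⟩
    exact Submodule.subset_span ⟨y, hy, k + 1, by rw [pow_succ', Module.End.mul_apply]⟩
  · simp
  · intro y z _ _ hy hz
    rw [map_add]
    exact add_mem hy hz
  · intro c y _ hy
    rw [map_smul]
    exact Submodule.smul_mem _ c hy

/-- The space with basis `T ^ j a_i`, `0 ≤ j ≤ v i`, for three Jordan chains of lengths
`v 0 + 1`, `v 1 + 1`, `v 2 + 1`. A vector is given by its coordinates `x i j`. -/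
abbrev JordanSpace (v : Fin 3 → ℕ) : Type := (i : Fin 3) → Fin (v i + 1) → ℂ

/-- The Jordan operator: it sends `T ^ j a_i` to `T ^ (j + 1) a_i` and kills `T ^ (v i) a_i`. -/
def jordanOp (v : Fin 3 → ℕ) : JordanSpace v →ₗ[ℂ] JordanSpace v where
  toFun x i j := if (j : ℕ) = 0 then 0 else x i ⟨j - 1, by omega⟩
  map_add' x y := by
    funext i j
    simp only [Pi.add_apply]
    split_ifs <;> simp
  map_smul' c x := by
    funext i j
    simp only [Pi.smul_apply, RingHom.id_apply]
    split_ifs <;> simp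

/-- The generator `a_i` of the `i`-th Jordan chain. -/
def jordanGen (v : Fin 3 → ℕ) (i : Fin 3) : JordanSpace v := Pi.single i (Pi.single 0 1)

/-- The triple with three Jordan blocks of sizes `v i + 1`, whose subspace is `vect_T(Y)`, where
`Y` is an expression in the Jordan operator `T` and the generators `a`. -/
def jordanTriple (v : Fin 3 → ℕ)
    (Y : (JordanSpace v →ₗ[ℂ] JordanSpace v) → (Fin 3 → JordanSpace v) → Set (JordanSpace v)) :
    InvTriple.{0} where
  V := JordanSpace v
  T := jordanOp v
  U := vectT (jordanOp v) (Y (jordanOp v) (jordanGen v))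
  invariant := vectT_invariant _ _

/-- The eight triples of the classification for `p = 5`, `n_V = 3`, `n_U = 2`; the generators
`a_1, a_2, a_3` of the Jordan chains are `a 0, a 1, a 2`. -/
def indecList : Fin 8 → InvTriple.{0} := ![
  jordanTriple ![0, 2, 4] fun T a => {(T ^ 2) (a 1), (T ^ 2) (a 2) + T (a 1) + a 0},
  jordanTriple ![1, 2, 4] fun T a => {T (a 1), T (a 2) + a 1 + a 0},
  jordanTriple ![1, 2, 4] fun T a => {T (a 0), (T ^ 2) (a 2) + T (a 1) + a 0},
  jordanTriple ![0, 2, 4] fun T a => {a 0 + T (a 1), (T ^ 2) (a 2) + a 0},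
  jordanTriple ![1, 3, 4] fun T a => {T (a 0) + (T ^ 2) (a 1), T (a 2) + a 0},
  jordanTriple ![1, 4, 4] fun T a => {T (a 0) + (T ^ 3) (a 1), T (a 2) + a 0},
  jordanTriple ![1, 3, 4] fun T a => {a 0 + T (a 1), (T ^ 3) (a 2) + T (a 0)},
  jordanTriple ![0, 2, 4] fun T a => {a 0 + T (a 1), T (a 2) + a 1}]

/-!
A triple `(V, T, U)` is regarded as a module over `ℂ[X]`, with `X` acting as `T`, together with a
submodule `U`. Since `n_V = 3`, the module is the direct sum of three Jordan chains
(`IsJordanTriple`, `exists_isJordanBasis`), and since `n_U = 2`, the submodule is generated by two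
elements but not by one.

For the completeness of the list, let `X ^ n` be the highest power of `X` dividing `U`, and let `w`
be a generator not divisible by `X ^ (n + 1)`. Rescaling the chain generators by units and
absorbing dominated terms, one can write `w` as `X ^ n a`, as `X ^ n a + X ^ q b`, or as
`X ^ n a + X ^ q b + X ^ s c`, with the exponents and the remaining lengths of the chains strictly
increasing. In the first case `a` splits off. In the second case a second generator can be reduced
modulo `w` to `X ^ r b + X ^ s c`, so that `U` is spanned by a string
(`IsJordanTriple.string_or_splits`). In the third case the bound `X ^ 5 = 0` forces `n = 0` and
chains of lengths `1`, `3`, `5`; then either another generator involves only two chains, or `U` is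
the first triple of the list (`IsJordanTriple.splits_or_of_tripod`).

A string is determined by seven natural numbers, bounded by five. Elementary changes of the Jordan
basis split it except for ten numerical types (`IsJordanTriple.string_splits_or`), and these are
the triples two to eight of the list in various bases (`HasStringForm.splits_or_hasForm`). All
eight forms have a chain of length five, so smaller orders of nilpotency do not occur.

Conversely, an endomorphism that preserves the submodule of one of the eight forms is, modulo `X`,
a matrix with constant diagonal that is triangular enough for an idempotent one to be `0` or `1`
(`exists_matrix`, `IsJordanTriple.idempotent_trivial`); hence the eight triples are
indecomposable. They are told apart by the dimensions of `V` and `U`.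
-/

open Polynomial

/-! ### Jordan bases over the polynomial ring -/

section JordanChains

variable {M : Type*} [AddCommGroup M] [Module ℂ[X] M]

/-- The vectors `a`, `b`, `c` generate Jordan chains of lengths `μ`, `ν`, `σ` of which the
`ℂ[X]`-module `M` is the direct sum. The lengths may be zero. -/
structure IsJordanTriple (μ ν σ : ℕ) (a b c : M) : Prop where
  generate : ∀ x : M, ∃ f g h : ℂ[X], x = f • a + g • b + h • c
  relation : ∀ f g h : ℂ[X], f • a + g • b + h • c = 0 ↔ X ^ μ ∣ f ∧ X ^ ν ∣ g ∧ X ^ σ ∣ h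

/-- A submodule `U` splits along a nontrivial direct sum decomposition of the ambient module. -/
def IsDecomposable (U : Submodule ℂ[X] M) : Prop :=
  ∃ P Q : Submodule ℂ[X] M, IsCompl P Q ∧ P ≠ ⊥ ∧ Q ≠ ⊥ ∧ U = (U ⊓ P) ⊔ (U ⊓ Q)

/-- A polynomial is divisible by `X ^ n` or is the product of a smaller power of `X` and a
polynomial with nonzero constant term. -/
theorem X_pow_dvd_or_eq (f : ℂ[X]) (n : ℕ) :
    X ^ n ∣ f ∨ ∃ k < n, ∃ u : ℂ[X], u.coeff 0 ≠ 0 ∧ f = X ^ k * u := by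
  by_cases hf : X ^ n ∣ f
  · exact .inl hf
  right
  induction n generalizing f with
  | zero => simp at hf
  | succ n ih =>
    by_cases h0 : f.coeff 0 = 0
    · obtain ⟨g, rfl⟩ := X_dvd_iff.2 h0
      have hg : ¬ X ^ n ∣ g := fun h => hf (by rw [pow_succ']; exact mul_dvd_mul_left X h)
      obtain ⟨k, hk, u, hu, rfl⟩ := ih g hg
      exact ⟨k + 1, by omega, u, hu, by ring⟩
    · exact ⟨0, by omega, f, h0, by simp⟩

theorem isCoprime_X_pow {u : ℂ[X]} (hu : u.coeff 0 ≠ 0) (n : ℕ) : IsCoprime (X ^ n) u :=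
  ((irreducible_X (R := ℂ)).coprime_iff_not_dvd.2 fun h => hu (X_dvd_iff.1 h)).pow_left

theorem smul_eq_zero_of_dvd {f g : ℂ[X]} {x : M} (h : f ∣ g) (hx : f • x = 0) : g • x = 0 := by
  obtain ⟨k, rfl⟩ := h
  rw [mul_comm, mul_smul, hx, smul_zero]

/-- Modulo `X ^ (n + 1)`, a polynomial with nonzero constant term is invertible. -/
theorem exists_inverse {u : ℂ[X]} (hu : u.coeff 0 ≠ 0) (n : ℕ) :
    ∃ v : ℂ[X], v.coeff 0 ≠ 0 ∧ X ^ (n + 1) ∣ v * u - 1 := by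
  obtain ⟨s, v, hsv⟩ := isCoprime_X_pow hu (n + 1)
  refine ⟨v, fun h => ?_, -s, by linear_combination hsv⟩
  have := congrArg (fun p => coeff p 0) hsv
  simp [mul_coeff_zero, h] at this

namespace IsJordanTriple

variable {μ ν σ : ℕ} {a b c : M}

theorem swap₁₂ (h : IsJordanTriple μ ν σ a b c) : IsJordanTriple ν μ σ b a c where
  generate x := by
    obtain ⟨f, g, k, rfl⟩ := h.generate x
    exact ⟨g, f, k, by abel⟩
  relation f g k := by
    rw [show f • b + g • a + k • c = g • a + f • b + k • c by abel, h.relation]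
    tauto

theorem swap₂₃ (h : IsJordanTriple μ ν σ a b c) : IsJordanTriple μ σ ν a c b where
  generate x := by
    obtain ⟨f, g, k, rfl⟩ := h.generate x
    exact ⟨f, k, g, by abel⟩
  relation f g k := by
    rw [show f • a + g • c + k • b = f • a + k • b + g • c by abel, h.relation]
    tauto

theorem swap₁₃ (h : IsJordanTriple μ ν σ a b c) : IsJordanTriple σ ν μ c b a :=
  h.swap₁₂.swap₂₃.swap₁₂

theorem smul_eq_zero_iff (h : IsJordanTriple μ ν σ a b c) (f : ℂ[X]) :
    f • a = 0 ↔ X ^ μ ∣ f := by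
  simpa using h.relation f 0 0

theorem pow_smul (h : IsJordanTriple μ ν σ a b c) : (X ^ μ : ℂ[X]) • a = 0 :=
  (h.smul_eq_zero_iff _).2 dvd_rfl

/-- Replacing the generator `a` by `u • a + g • b + k • c`, where `u` has nonzero constant term,
gives another Jordan basis as soon as the new generator is killed by `X ^ μ`. -/
theorem change (h : IsJordanTriple μ ν σ a b c) {u g k : ℂ[X]} (hu : u.coeff 0 ≠ 0)
    (h0 : (X ^ μ : ℂ[X]) • (g • b + k • c) = 0) :
    IsJordanTriple μ ν σ (u • a + g • b + k • c) b c where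
  generate x := by
    obtain ⟨p, q, r, rfl⟩ := h.generate x
    obtain ⟨s, v, hsv⟩ := isCoprime_X_pow hu μ
    refine ⟨p * v, q - p * v * g, r - p * v * k, ?_⟩
    have : (p * v * u) • a = p • a := by
      rw [show p * v * u = p - p * s * X ^ μ by linear_combination p * hsv, sub_smul, mul_smul,
        h.pow_smul, smul_zero, sub_zero]
    rw [← this]
    module
  relation f' g' k' := by
    rw [show f' • (u • a + g • b + k • c) + g' • b + k' • c
      = (f' * u) • a + (f' * g + g') • b + (f' * k + k') • c by module, h.relation]
    have key : X ^ μ ∣ f' → X ^ ν ∣ f' * g ∧ X ^ σ ∣ f' * k := fun hd => by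
      have := smul_eq_zero_of_dvd hd h0
      have h2 := (h.relation 0 (f' * g) (f' * k)).1 (by rw [← this]; module)
      exact h2.2
    constructor
    · rintro ⟨h1, h2, h3⟩
      replace h1 : X ^ μ ∣ f' := (isCoprime_X_pow hu μ).dvd_of_dvd_mul_right h1
      exact ⟨h1, (dvd_add_right (key h1).1).1 h2, (dvd_add_right (key h1).2).1 h3⟩
    · rintro ⟨h1, h2, h3⟩
      exact ⟨h1.mul_right u, (dvd_add_right (key h1).1).2 h2, (dvd_add_right (key h1).2).2 h3⟩

theorem unit_smul (h : IsJordanTriple μ ν σ a b c) {u : ℂ[X]} (hu : u.coeff 0 ≠ 0) :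
    IsJordanTriple μ ν σ (u • a) b c := by
  simpa using h.change (g := 0) (k := 0) hu (by simp)

theorem neg (h : IsJordanTriple μ ν σ a b c) : IsJordanTriple μ ν σ (-a) b c := by
  simpa using h.unit_smul (u := -1) (by simp)

theorem add_pow_smul (h : IsJordanTriple μ ν σ a b c) {n : ℕ} (hn : ν ≤ μ + n) :
    IsJordanTriple μ ν σ (a + (X ^ n : ℂ[X]) • b) b c := by
  simpa using h.change (u := 1) (g := X ^ n) (k := 0) (by simp) (by
    rw [zero_smul, add_zero, smul_smul, ← pow_add]
    exact smul_eq_zero_of_dvd (pow_dvd_pow X hn) h.swap₁₂.pow_smul)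

theorem sub_pow_smul (h : IsJordanTriple μ ν σ a b c) {n : ℕ} (hn : ν ≤ μ + n) :
    IsJordanTriple μ ν σ (a - (X ^ n : ℂ[X]) • b) b c := by
  simpa [sub_eq_add_neg] using (h.swap₁₂.neg.swap₁₂.add_pow_smul hn).swap₁₂.neg.swap₁₂

theorem isCompl (h : IsJordanTriple μ ν σ a b c) :
    IsCompl (Submodule.span ℂ[X] {a}) (Submodule.span ℂ[X] {b, c}) := by
  constructor
  · rw [Submodule.disjoint_def]
    intro x hx hx'
    obtain ⟨f, rfl⟩ := Submodule.mem_span_singleton.1 hx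
    obtain ⟨g, k, hgk⟩ := Submodule.mem_span_pair.1 hx'
    rw [h.smul_eq_zero_iff]
    exact ((h.relation f (-g) (-k)).1 (by rw [← hgk]; module)).1
  · rw [codisjoint_iff, eq_top_iff]
    rintro x -
    obtain ⟨f, g, k, rfl⟩ := h.generate x
    rw [add_assoc]
    exact Submodule.add_mem_sup (Submodule.smul_mem _ _ (Submodule.mem_span_singleton_self a))
      (Submodule.mem_span_pair.2 ⟨g, k, rfl⟩)

theorem ne_zero (h : IsJordanTriple μ ν σ a b c) (hμ : 0 < μ) : a ≠ 0 := fun h0 => by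
  have := (h.smul_eq_zero_iff 1).1 (by simp [h0])
  exact hμ.ne' (by
    simpa using (isUnit_pow_iff_of_not_isUnit not_isUnit_X).1 (isUnit_of_dvd_one this))

/-- A submodule with two generators, each of which lies in `⟨a⟩` or in `⟨b, c⟩`, splits. -/
theorem splits (h : IsJordanTriple μ ν σ a b c) (hμ : 0 < μ) (hν : 0 < ν) {y z : M}
    (hy : (∃ f : ℂ[X], y = f • a) ∨ ∃ g k : ℂ[X], y = g • b + k • c)
    (hz : (∃ f : ℂ[X], z = f • a) ∨ ∃ g k : ℂ[X], z = g • b + k • c) :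
    IsDecomposable (Submodule.span ℂ[X] {y, z}) := by
  refine ⟨_, _, h.isCompl, ?_, ?_, ?_⟩
  · simpa using h.ne_zero hμ
  · intro h0
    apply h.swap₁₂.ne_zero hν
    rw [← Submodule.mem_bot ℂ[X], ← h0]
    exact Submodule.subset_span (by simp)
  · have hmem : ∀ x : M, ((∃ f : ℂ[X], x = f • a) ∨ ∃ g k : ℂ[X], x = g • b + k • c) →
        x ∈ Submodule.span ℂ[X] {a} ∨ x ∈ Submodule.span ℂ[X] {b, c} := by
      rintro x (⟨f, rfl⟩ | ⟨g, k, rfl⟩)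
      · exact .inl (Submodule.smul_mem _ _ (Submodule.mem_span_singleton_self a))
      · exact .inr (Submodule.mem_span_pair.2 ⟨g, k, rfl⟩)
    apply le_antisymm
    · rw [Submodule.span_le]
      rintro x (rfl | rfl)
      · have hx : x ∈ Submodule.span ℂ[X] {x, z} := Submodule.subset_span (by simp)
        rcases hmem x hy with h1 | h1
        · exact Submodule.mem_sup_left ⟨hx, h1⟩
        · exact Submodule.mem_sup_right ⟨hx, h1⟩
      · have hx : x ∈ Submodule.span ℂ[X] {y, x} := Submodule.subset_span (by simp)
        rcases hmem x hz with h1 | h1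
        · exact Submodule.mem_sup_left ⟨hx, h1⟩
        · exact Submodule.mem_sup_right ⟨hx, h1⟩
    · exact sup_le inf_le_left inf_le_left

end IsJordanTriple

theorem span_pair_eq_of_mem {y z y' z' : M}
    (h₁ : ∃ p q : ℂ[X], y' = p • y + q • z) (h₂ : ∃ p q : ℂ[X], z' = p • y + q • z)
    (h₃ : ∃ p q : ℂ[X], y = p • y' + q • z') (h₄ : ∃ p q : ℂ[X], z = p • y' + q • z') :
    Submodule.span ℂ[X] {y, z} = Submodule.span ℂ[X] {y', z'} := by
  have aux : ∀ {x u v : M}, (∃ p q : ℂ[X], x = p • u + q • v) →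
      x ∈ (Submodule.span ℂ[X] {u, v} : Set M) := fun ⟨p, q, h⟩ =>
    Submodule.mem_span_pair.2 ⟨p, q, h.symm⟩
  apply le_antisymm <;> rw [Submodule.span_le] <;> rintro x (rfl | rfl)
  exacts [aux h₃, aux h₄, aux h₁, aux h₂]

/-- The submodule generated by a pair does not change when a multiple of one generator is added
to the other. -/
theorem span_pair_add_smul (y z : M) (f : ℂ[X]) :
    Submodule.span ℂ[X] {y, z} = Submodule.span ℂ[X] {y, z + f • y} :=
  span_pair_eq_of_mem ⟨1, 0, by module⟩ ⟨f, 1, by module⟩ ⟨1, 0, by module⟩ ⟨-f, 1, by module⟩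

theorem span_pair_add_smul' (y z : M) (f : ℂ[X]) :
    Submodule.span ℂ[X] {y, z} = Submodule.span ℂ[X] {y + f • z, z} := by
  rw [Set.pair_comm, span_pair_add_smul, Set.pair_comm]

end JordanChains

section Strings

variable {M : Type*} [AddCommGroup M] [Module ℂ[X] M]

/-! ### Strings -/

/-- The submodule generated by a string: chains `a`, `b`, `c`, the generator `X ^ p a + X ^ q b`
linking the first two chains and the generator `X ^ r b + X ^ s c` linking the last two. -/
noncomputable def stringSpan (p q r s : ℕ) (a b c : M) : Submodule ℂ[X] M :=
  Submodule.span ℂ[X]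
    {(X ^ p : ℂ[X]) • a + (X ^ q : ℂ[X]) • b, (X ^ r : ℂ[X]) • b + (X ^ s : ℂ[X]) • c}

namespace IsJordanTriple

variable {α β γ p q r s : ℕ} {a b c : M}

/-- The multiple `X ^ r b` already lies in the span of the first generator, so the second
generator may be replaced by `X ^ s c`. -/
theorem string_splits_of_vanish (h : IsJordanTriple α β γ a b c) (hβ : 0 < β)
    (hγ : 0 < γ) (hq : q ≤ r) (h1 : α + q ≤ r + p) : IsDecomposable (stringSpan p q r s a b c) := by
  obtain ⟨d, rfl⟩ := Nat.exists_eq_add_of_le hq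
  have ha : (X ^ (d + p) : ℂ[X]) • a = 0 := (h.smul_eq_zero_iff _).2 (pow_dvd_pow X (by omega))
  rw [stringSpan, span_pair_eq_of_mem (y' := (X ^ p : ℂ[X]) • a + (X ^ q : ℂ[X]) • b)
    (z' := (X ^ s : ℂ[X]) • c) ⟨1, 0, by module⟩
    ⟨-X ^ d, 1, by linear_combination (norm := module) ha⟩ ⟨1, 0, by module⟩
    ⟨X ^ d, 1, by linear_combination (norm := module) -ha⟩]
  exact h.swap₁₃.splits hγ hβ (.inr ⟨X ^ q, X ^ p, by module⟩) (.inl ⟨X ^ s, rfl⟩)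

/-- The second generator is `X ^ s c'` for the new generator `c' = c + X ^ (r - s) b`. -/
theorem string_splits_of_absorb_right (h : IsJordanTriple α β γ a b c) (hβ : 0 < β) (hγ : 0 < γ)
    (hs : s ≤ r) (h1 : β + s ≤ γ + r) : IsDecomposable (stringSpan p q r s a b c) := by
  obtain ⟨d, rfl⟩ := Nat.exists_eq_add_of_le hs
  exact (h.swap₁₃.add_pow_smul (n := d) (by omega)).splits hγ hβ
    (.inr ⟨X ^ q, X ^ p, by module⟩) (.inl ⟨X ^ s, by module⟩)

/-- With `b' = b + X ^ (s - r) c` the second generator is `X ^ r b'`, and the error term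
`X ^ (q + s - r) c` of the first generator vanishes. -/
theorem string_splits_of_absorb_middle_of_vanish (h : IsJordanTriple α β γ a b c) (hβ : 0 < β)
    (hγ : 0 < γ) (hr : r ≤ s) (h1 : γ + r ≤ β + s) (h2 : γ + r ≤ q + s) :
    IsDecomposable (stringSpan p q r s a b c) := by
  obtain ⟨d, rfl⟩ := Nat.exists_eq_add_of_le hr
  have hc : (X ^ (q + d) : ℂ[X]) • c = 0 :=
    (h.swap₁₃.smul_eq_zero_iff _).2 (pow_dvd_pow X (by omega))
  exact (h.swap₂₃.swap₁₃.add_pow_smul (n := d) (by omega)).swap₁₂.splits hγ hβ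
    (.inr ⟨X ^ q, X ^ p, by linear_combination (norm := module) -hc⟩)
    (.inr ⟨X ^ r, 0, by module⟩)

/-- With `b' = b + X ^ (s - r) c` the second generator is `X ^ r b'`, and the error term
`X ^ (q + s - r) c` of the first generator is absorbed into `a`. -/
theorem string_splits_of_absorb_middle_of_absorb (h : IsJordanTriple α β γ a b c) (hα : 0 < α)
    (hγ : 0 < γ) (hr : r ≤ s) (h1 : γ + r ≤ β + s) (h2 : r + p ≤ q + s)
    (h3 : γ + p + r ≤ α + q + s) : IsDecomposable (stringSpan p q r s a b c) := by
  obtain ⟨d, rfl⟩ := Nat.exists_eq_add_of_le hr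
  obtain ⟨e, he⟩ := Nat.exists_eq_add_of_le (show p ≤ q + d by omega)
  have hX : (X ^ q * X ^ d : ℂ[X]) = X ^ p * X ^ e := by rw [← pow_add, he, pow_add]
  have hc : (X ^ q * X ^ d : ℂ[X]) • c = (X ^ p * X ^ e : ℂ[X]) • c := by rw [hX]
  have hb := (h.swap₂₃.swap₁₃.add_pow_smul (n := d) (by omega))
  exact (hb.swap₁₃.swap₂₃.swap₂₃.sub_pow_smul (n := e) (by omega)).swap₁₂.splits hγ hα
    (.inr ⟨X ^ p, X ^ q, by linear_combination (norm := module) -hc⟩)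
    (.inr ⟨0, X ^ r, by module⟩)

/-- Modulo the second generator, the first one is `X ^ p a'` for
`a' = a - X ^ (q + s - p - r) c`. -/
theorem string_splits_of_absorb_left (h : IsJordanTriple α β γ a b c) (hα : 0 < α) (hβ : 0 < β)
    (hr : r ≤ q) (h2 : p + r ≤ q + s) (h3 : γ + p + r ≤ α + q + s) :
    IsDecomposable (stringSpan p q r s a b c) := by
  obtain ⟨d, rfl⟩ := Nat.exists_eq_add_of_le hr
  obtain ⟨e, he⟩ := Nat.exists_eq_add_of_le (show p ≤ d + s by omega)
  have hX : (X ^ d * X ^ s : ℂ[X]) = X ^ p * X ^ e := by rw [← pow_add, he, pow_add]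
  have hc : (X ^ d * X ^ s : ℂ[X]) • c = (X ^ p * X ^ e : ℂ[X]) • c := by rw [hX]
  rw [stringSpan, span_pair_eq_of_mem (y' := (X ^ p : ℂ[X]) • (a - (X ^ e : ℂ[X]) • c))
    (z' := (X ^ r : ℂ[X]) • b + (X ^ s : ℂ[X]) • c)
    ⟨1, -X ^ d, by linear_combination (norm := module) hc⟩ ⟨0, 1, by module⟩
    ⟨1, X ^ d, by linear_combination (norm := module) -hc⟩ ⟨0, 1, by module⟩]
  exact (h.swap₂₃.sub_pow_smul (n := e) (by omega)).swap₂₃.splits hα hβ (.inl ⟨X ^ p, rfl⟩)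
    (.inr ⟨X ^ r, X ^ s, rfl⟩)

/-- Modulo the first generator, the second one is `X ^ s c'` for
`c' = c - X ^ (p + r - q - s) a`. -/
theorem string_splits_of_absorb_across (h : IsJordanTriple α β γ a b c) (hβ : 0 < β) (hγ : 0 < γ)
    (hq : q ≤ r) (h2 : q + s ≤ p + r) (h3 : α + q + s ≤ γ + p + r) :
    IsDecomposable (stringSpan p q r s a b c) := by
  obtain ⟨d, rfl⟩ := Nat.exists_eq_add_of_le hq
  obtain ⟨e, he⟩ := Nat.exists_eq_add_of_le (show s ≤ d + p by omega)
  have hX : (X ^ d * X ^ p : ℂ[X]) = X ^ s * X ^ e := by rw [← pow_add, he, pow_add]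
  have ha : (X ^ d * X ^ p : ℂ[X]) • a = (X ^ s * X ^ e : ℂ[X]) • a := by rw [hX]
  rw [stringSpan, span_pair_eq_of_mem (y' := (X ^ p : ℂ[X]) • a + (X ^ q : ℂ[X]) • b)
    (z' := (X ^ s : ℂ[X]) • (c - (X ^ e : ℂ[X]) • a)) ⟨1, 0, by module⟩
    ⟨-X ^ d, 1, by linear_combination (norm := module) ha⟩ ⟨1, 0, by module⟩
    ⟨X ^ d, 1, by linear_combination (norm := module) -ha⟩]
  exact (h.swap₁₃.swap₂₃.sub_pow_smul (n := e) (by omega)).swap₂₃.splits hγ hβ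
    (.inr ⟨X ^ q, X ^ p, by module⟩) (.inl ⟨X ^ s, rfl⟩)

/-- With `b' = b + X ^ (s - r) c` the second generator is `X ^ r b'`, and modulo it the first one
involves only `a` and `c`. -/
theorem string_splits_of_absorb_middle (h : IsJordanTriple α β γ a b c) (hα : 0 < α) (hβ : 0 < β)
    (hr : r ≤ s) (hq : r ≤ q) (h1 : γ + r ≤ β + s) : IsDecomposable (stringSpan p q r s a b c) := by
  obtain ⟨d, rfl⟩ := Nat.exists_eq_add_of_le hr
  obtain ⟨e, rfl⟩ := Nat.exists_eq_add_of_le hq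
  rw [stringSpan, span_pair_eq_of_mem
    (y' := (X ^ p : ℂ[X]) • a - (X ^ (e + (r + d)) : ℂ[X]) • c)
    (z' := (X ^ r : ℂ[X]) • b + (X ^ (r + d) : ℂ[X]) • c)
    ⟨1, -X ^ e, by module⟩ ⟨0, 1, by module⟩ ⟨1, X ^ e, by module⟩ ⟨0, 1, by module⟩]
  exact (h.swap₂₃.swap₁₃.add_pow_smul (n := d) (by omega)).swap₂₃.splits hβ hα
    (.inr ⟨X ^ p, -X ^ (e + (r + d)), by module⟩) (.inl ⟨X ^ r, by module⟩)

set_option synthInstance.maxSize 4000 in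
set_option synthInstance.maxHeartbeats 800000 in
/-- The numerical types of the strings of chains of length at most five to which none of the
splitting criteria applies. -/
theorem string_types (hα5 : α ≤ 5) (hβ5 : β ≤ 5) (hp : p < α) (hpq : p < q) (hgap : α + q < β + p) :
    ∀ γ < 6, ∀ r < β, p ≤ r → ∀ s < γ, p ≤ s →
    (q ≤ r ∧ α + q ≤ r + p) ∨ (s ≤ r ∧ β + s ≤ γ + r) ∨
    (r ≤ s ∧ γ + r ≤ β + s ∧ γ + r ≤ q + s) ∨
    (r ≤ s ∧ γ + r ≤ β + s ∧ r + p ≤ q + s ∧ γ + p + r ≤ α + q + s) ∨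
    (r ≤ q ∧ p + r ≤ q + s ∧ γ + p + r ≤ α + q + s) ∨
    (q ≤ r ∧ q + s ≤ p + r ∧ α + q + s ≤ γ + p + r) ∨ (r ≤ s ∧ r ≤ q ∧ γ + r ≤ β + s) ∨
    [α, β, γ, p, q, r, s] ∈ [[1, 3, 5, 0, 1, 0, 1], [1, 5, 3, 0, 2, 1, 0], [3, 5, 1, 0, 1, 2, 0],
      [1, 3, 5, 0, 1, 1, 2], [1, 5, 3, 0, 2, 2, 1], [2, 4, 5, 0, 1, 2, 3], [2, 5, 4, 0, 1, 2, 2],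
      [2, 5, 5, 0, 1, 2, 3], [2, 5, 3, 0, 2, 3, 2], [3, 5, 2, 0, 1, 2, 1]] := by
  interval_cases α <;> interval_cases β <;> first | omega | skip
  all_goals interval_cases p <;> first | omega | skip
  all_goals
    obtain ⟨d, rfl⟩ := Nat.exists_eq_add_of_lt hpq
    have hd : d ≤ 2 := by omega
    interval_cases d <;> first | omega | decide +kernel

/-- A string of chains of length at most five splits or is of one of ten numerical types. -/
theorem string_splits_or (h : IsJordanTriple α β γ a b c) (hα5 : α ≤ 5) (hβ5 : β ≤ 5) (hγ5 : γ ≤ 5)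
    (hp : p < α) (hpq : p < q) (hq : q < β) (hgap : α + q < β + p) (hpr : p ≤ r) (hr : r < β)
    (hps : p ≤ s) (hs : s < γ) :
    IsDecomposable (stringSpan p q r s a b c) ∨
    [α, β, γ, p, q, r, s] ∈ [[1, 3, 5, 0, 1, 0, 1], [1, 5, 3, 0, 2, 1, 0], [3, 5, 1, 0, 1, 2, 0],
      [1, 3, 5, 0, 1, 1, 2], [1, 5, 3, 0, 2, 2, 1], [2, 4, 5, 0, 1, 2, 3], [2, 5, 4, 0, 1, 2, 2],
      [2, 5, 5, 0, 1, 2, 3], [2, 5, 3, 0, 2, 3, 2], [3, 5, 2, 0, 1, 2, 1]] := by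
  have hα : 0 < α := by omega
  have hβ : 0 < β := by omega
  have hγ : 0 < γ := by omega
  rcases string_types hα5 hβ5 hp hpq hgap γ (by omega) r hr hpr s hs hps
    with c | c | c | c | c | c | c | c
  · exact .inl (h.string_splits_of_vanish hβ hγ c.1 c.2)
  · exact .inl (h.string_splits_of_absorb_right hβ hγ c.1 c.2)
  · exact .inl (h.string_splits_of_absorb_middle_of_vanish hβ hγ c.1 c.2.1 c.2.2)
  · exact .inl (h.string_splits_of_absorb_middle_of_absorb hα hγ c.1 c.2.1 c.2.2.1 c.2.2.2)
  · exact .inl (h.string_splits_of_absorb_left hα hβ c.1 c.2.1 c.2.2)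
  · exact .inl (h.string_splits_of_absorb_across hβ hγ c.1 c.2.1 c.2.2)
  · exact .inl (h.string_splits_of_absorb_middle hα hβ c.1 c.2.1 c.2.2)
  · exact .inr c

end IsJordanTriple
end Strings

section NormalForms

variable {M : Type*} [AddCommGroup M] [Module ℂ[X] M]

/-! ### Normal forms of two-generated submodules -/

/-- `U` is the span of a string whose first generator joins the shorter chain `a` to the longer
chain `b` so that neither of its two terms can be absorbed into the other. -/
def HasStringForm (U : Submodule ℂ[X] M) : Prop :=
  ∃ (α β γ p q r s : ℕ) (a b c : M), IsJordanTriple α β γ a b c ∧ p < α ∧ p < q ∧ q < β ∧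
    α + q < β + p ∧ p ≤ r ∧ r < β ∧ p ≤ s ∧ s < γ ∧ U = stringSpan p q r s a b c

/-- `U` is generated by `X ^ 2 b` and `X ^ 2 c + X b + a` for chains `a`, `b`, `c` of lengths
one, three and five. -/
def HasTripodForm (U : Submodule ℂ[X] M) : Prop :=
  ∃ a b c : M, IsJordanTriple 1 3 5 a b c ∧ U = Submodule.span ℂ[X]
    {(X ^ 2 : ℂ[X]) • b, (X ^ 2 : ℂ[X]) • c + (X : ℂ[X]) • b + a}

namespace IsJordanTriple

variable {μ ν σ n : ℕ} {a b c w z : M}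

/-- A multiple `X ^ n f a` vanishes or is `X ^ (n + k) u a` for some `u` with nonzero constant term,
where `X ^ (n + k) a ≠ 0`. -/
theorem X_pow_smul_or (h : IsJordanTriple μ ν σ a b c) (n : ℕ) (f : ℂ[X]) :
    (X ^ n : ℂ[X]) • f • a = 0 ∨ ∃ k : ℕ, n + k < μ ∧ ∃ u : ℂ[X], u.coeff 0 ≠ 0 ∧
      (X ^ n : ℂ[X]) • f • a = (X ^ (n + k) : ℂ[X]) • u • a := by
  rcases X_pow_dvd_or_eq f (μ - n) with hf | ⟨k, hk, u, hu, rfl⟩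
  · left
    rw [smul_smul, h.smul_eq_zero_iff]
    refine (pow_dvd_pow X (show μ ≤ n + (μ - n) by omega)).trans ?_
    rw [pow_add]
    exact mul_dvd_mul_left _ hf
  · exact .inr ⟨k, by omega, u, hu, by module⟩

/-- If one generator is `X ^ n a` and the other one is divisible by `X ^ n`, then `a` splits
off. -/
theorem splits_of_pow_smul (h : IsJordanTriple μ ν σ a b c) (hμ : 0 < μ) (hν : 0 < ν)
    (hz : ∃ x : M, z = (X ^ n : ℂ[X]) • x) :
    IsDecomposable (Submodule.span ℂ[X] {(X ^ n : ℂ[X]) • a, z}) := by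
  obtain ⟨x, rfl⟩ := hz
  obtain ⟨f, g, k, rfl⟩ := h.generate x
  rw [span_pair_add_smul _ _ (-f)]
  exact h.splits hμ hν (.inl ⟨_, rfl⟩) (.inr ⟨X ^ n * g, X ^ n * k, by module⟩)

/-- If one generator is `X ^ n a + X ^ (n + k) b`, with neither term absorbed into the other, then
the second one can be reduced modulo it to a combination of `b` and `c`, whose unit factors are
absorbed into the generator and into `c`. -/
theorem string_or_splits (h : IsJordanTriple μ ν σ a b c) (h5 : ∀ x : M, (X ^ 5 : ℂ[X]) • x = 0)
    (hν : 0 < ν) (hσ : 0 < σ) {k : ℕ} (hn : n < μ) (hk : 0 < k) (hkν : n + k < ν)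
    (hgap : μ + k < ν) (hz : ∃ x : M, z = (X ^ n : ℂ[X]) • x) :
    IsDecomposable (Submodule.span ℂ[X] {(X ^ n : ℂ[X]) • a + (X ^ (n + k) : ℂ[X]) • b, z}) ∨
    HasStringForm (Submodule.span ℂ[X] {(X ^ n : ℂ[X]) • a + (X ^ (n + k) : ℂ[X]) • b, z}) := by
  obtain ⟨x, rfl⟩ := hz
  obtain ⟨f, g, l, rfl⟩ := h.generate x
  rw [span_pair_add_smul _ _ (-f), show (X ^ n : ℂ[X]) • (f • a + g • b + l • c) +
    -f • ((X ^ n : ℂ[X]) • a + (X ^ (n + k) : ℂ[X]) • b) =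
    (X ^ n : ℂ[X]) • (g - X ^ k * f) • b + (X ^ n : ℂ[X]) • l • c by module]
  have hab : ∃ g' k' : ℂ[X], (X ^ n : ℂ[X]) • a + (X ^ (n + k) : ℂ[X]) • b = g' • b + k' • a :=
    ⟨X ^ (n + k), X ^ n, by module⟩
  rcases h.swap₁₂.X_pow_smul_or n (g - X ^ k * f) with h0 | ⟨i, hi, u, hu, hui⟩
  · rw [h0, zero_add]
    exact .inl (h.swap₁₃.splits hσ hν (.inr hab) (.inl ⟨X ^ n * l, by module⟩))
  rcases h.swap₁₃.X_pow_smul_or n l with h0 | ⟨j, hj, v, hv, hvj⟩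
  · rw [h0, add_zero, hui]
    exact .inl (h.swap₁₃.splits hσ hν (.inr hab) (.inr ⟨X ^ (n + i) * u, 0, by module⟩))
  rw [hui, hvj]
  obtain ⟨u', hu', hu1⟩ := exists_inverse hu 4
  have hinv : ∀ x : M, (u' * u) • x = x := fun x => by
    have := smul_eq_zero_of_dvd hu1 (h5 x)
    rwa [sub_smul, one_smul, sub_eq_zero] at this
  refine .inr ⟨μ, ν, σ, n, n + k, n + i, n + j, a, b, (u' * v) • c,
    (h.swap₁₃.unit_smul (u := u' * v) ?_).swap₁₃, hn, by omega, hkν, by omega, by omega, hi,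
    by omega, hj, ?_⟩
  · rw [mul_coeff_zero]
    exact mul_ne_zero hu' hv
  have h1 := hinv ((X ^ (n + i) : ℂ[X]) • b)
  have h2 := hinv ((X ^ (n + j) * v : ℂ[X]) • c)
  refine span_pair_eq_of_mem ⟨1, 0, by module⟩ ⟨0, u', ?_⟩ ⟨1, 0, by module⟩ ⟨0, u, ?_⟩
  · linear_combination (norm := module) -h1
  · linear_combination (norm := module) -h2

/-- The case of a generator that involves only two of the three chains, with nonzero leading
coefficient at the first one. -/
theorem string_or_splits_of_two_chains_aux (h : IsJordanTriple μ ν σ a b c)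
    (h5 : ∀ x : M, (X ^ 5 : ℂ[X]) • x = 0) (hμ : 0 < μ) (hν : 0 < ν) (hσ : 0 < σ) {f g : ℂ[X]}
    (hf : f.coeff 0 ≠ 0) (hw : w = (X ^ n : ℂ[X]) • (f • a + g • b))
    (hw' : ¬ ∃ x : M, w = (X ^ (n + 1) : ℂ[X]) • x) (hz : ∃ x : M, z = (X ^ n : ℂ[X]) • x) :
    IsDecomposable (Submodule.span ℂ[X] {w, z}) ∨ HasStringForm (Submodule.span ℂ[X] {w, z}) := by
  replace h := h.unit_smul hf
  generalize f • a = a' at h hw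
  rw [smul_add] at hw
  rcases h.swap₁₂.X_pow_smul_or n g with h0 | ⟨k, hk, u, hu, huk⟩
  · rw [h0, add_zero] at hw
    exact .inl (hw ▸ h.splits_of_pow_smul hμ hν hz)
  rw [huk] at hw
  replace h := (h.swap₁₂.unit_smul hu).swap₁₂
  generalize u • b = b' at h hw
  by_cases h1 : ν ≤ μ + k
  · left
    rw [hw, show (X ^ n : ℂ[X]) • a' + (X ^ (n + k) : ℂ[X]) • b'
      = (X ^ n : ℂ[X]) • (a' + (X ^ k : ℂ[X]) • b') by module]
    exact (h.add_pow_smul h1).splits_of_pow_smul hμ hν hz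
  rcases Nat.eq_zero_or_pos k with rfl | hk0
  · left
    rw [hw, show (X ^ n : ℂ[X]) • a' + (X ^ (n + 0) : ℂ[X]) • b'
      = (X ^ n : ℂ[X]) • (b' + (X ^ 0 : ℂ[X]) • a') by module]
    exact (h.swap₁₂.add_pow_smul (by omega)).splits_of_pow_smul hν hμ hz
  have hn : n < μ := by
    by_contra! hn
    obtain ⟨j, rfl⟩ := Nat.exists_eq_add_of_lt hk0
    apply hw'
    rw [hw, (h.smul_eq_zero_iff _).2 (pow_dvd_pow X hn)]
    exact ⟨(X ^ j : ℂ[X]) • b', by module⟩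
  rw [hw]
  exact h.string_or_splits h5 hν hσ hn hk0 hk (by omega) hz

/-- A combination of `a` and `b` divisible by `X ^ n` is `X ^ n` times a combination of `a`
and `b`. -/
theorem exists_eq_X_pow_smul (h : IsJordanTriple μ ν σ a b c) {f g : ℂ[X]}
    (hx : ∃ x : M, f • a + g • b = (X ^ n : ℂ[X]) • x) :
    ∃ f' g' : ℂ[X], f • a + g • b = (X ^ n : ℂ[X]) • (f' • a + g' • b) := by
  obtain ⟨x, hx⟩ := hx
  obtain ⟨p, q, r, rfl⟩ := h.generate x
  have := ((h.relation (f - X ^ n * p) (g - X ^ n * q) (-(X ^ n * r))).1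
    (by linear_combination (norm := module) hx)).2.2
  have hc := (h.swap₁₃.smul_eq_zero_iff _).2 this
  exact ⟨p, q, by linear_combination (norm := module) hx - hc⟩

/-- The case of a generator that involves only two of the three chains. -/
theorem string_or_splits_of_two_chains (h : IsJordanTriple μ ν σ a b c)
    (h5 : ∀ x : M, (X ^ 5 : ℂ[X]) • x = 0) (hμ : 0 < μ) (hν : 0 < ν) (hσ : 0 < σ)
    (hw : ∃ f g : ℂ[X], w = f • a + g • b) (hwn : ∃ x : M, w = (X ^ n : ℂ[X]) • x)
    (hw' : ¬ ∃ x : M, w = (X ^ (n + 1) : ℂ[X]) • x) (hz : ∃ x : M, z = (X ^ n : ℂ[X]) • x) :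
    IsDecomposable (Submodule.span ℂ[X] {w, z}) ∨ HasStringForm (Submodule.span ℂ[X] {w, z}) := by
  obtain ⟨f, g, hfg⟩ := hw
  obtain ⟨f', g', hfg'⟩ := h.exists_eq_X_pow_smul (hfg ▸ hwn)
  rw [← hfg] at hfg'
  by_cases hf : f'.coeff 0 = 0
  · by_cases hg : g'.coeff 0 = 0
    · obtain ⟨p, rfl⟩ := X_dvd_iff.2 hf
      obtain ⟨q, rfl⟩ := X_dvd_iff.2 hg
      exact absurd ⟨p • a + q • b, by rw [hfg']; module⟩ hw'
    · exact h.swap₁₂.string_or_splits_of_two_chains_aux h5 hν hμ hσ hg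
        (by rw [hfg', add_comm]) hw' hz
  · exact h.string_or_splits_of_two_chains_aux h5 hμ hν hσ hf hfg' hw' hz

end IsJordanTriple

end NormalForms

/-! ### Generators involving three chains -/

section Tripods

variable {M : Type*} [AddCommGroup M] [Module ℂ[X] M]

namespace IsJordanTriple

variable {μ ν σ n : ℕ} {a b c w z : M}

theorem coeff_zero_of_eq_X_smul (h : IsJordanTriple μ ν σ a b c) (hμ : 0 < μ) {f g k : ℂ[X]} {x : M}
    (hx : f • a + g • b + k • c = (X : ℂ[X]) • x) : f.coeff 0 = 0 := by
  obtain ⟨p, q, r, rfl⟩ := h.generate x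
  have h1 := ((h.relation (f - X * p) (g - X * q) (k - X * r)).1
    (by linear_combination (norm := module) hx)).1
  have h2 := X_dvd_iff.1 ((dvd_pow_self X hμ.ne').trans h1)
  simpa using h2

theorem le_five (h : IsJordanTriple μ ν σ a b c) (h5 : ∀ x : M, (X ^ 5 : ℂ[X]) • x = 0) :
    μ ≤ 5 :=
  (pow_dvd_pow_iff X_ne_zero not_isUnit_X).1 ((h.smul_eq_zero_iff _).1 (h5 a))

/-- One generator is `a + X b + X ^ 2 c`. Either some other generator involves only two
chains, or the submodule is in the tripod form. -/
theorem splits_or_of_tripod (h : IsJordanTriple 1 3 5 a b c)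
    (h5 : ∀ x : M, (X ^ 5 : ℂ[X]) • x = 0) (hw : w = a + (X : ℂ[X]) • b + (X ^ 2 : ℂ[X]) • c)
    (hcyc : ∀ x : M, Submodule.span ℂ[X] {w, z} ≠ Submodule.span ℂ[X] {x}) :
    IsDecomposable (Submodule.span ℂ[X] {w, z}) ∨ HasStringForm (Submodule.span ℂ[X] {w, z}) ∨
      HasTripodForm (Submodule.span ℂ[X] {w, z}) := by
  have hzero : ∀ x : M, ∃ y : M, x = (X ^ 0 : ℂ[X]) • y := fun x => ⟨x, by simp⟩
  obtain ⟨f, g, k, hz⟩ := h.generate z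
  rw [span_pair_add_smul w z (-f)] at hcyc ⊢
  have hz1 : z + -f • w = (g - f * X) • b + (k - f * X ^ 2) • c := by rw [hz, hw]; module
  generalize z + -f • w = z₁ at hcyc hz1 ⊢
  generalize g - f * X = g₁ at hz1
  generalize k - f * X ^ 2 = k₁ at hz1
  have ha : (X : ℂ[X]) • a = 0 := by simpa using h.pow_smul
  have hb : (X ^ 3 : ℂ[X]) • b = 0 := h.swap₁₂.pow_smul
  -- if `z₁` is not divisible by `X`, it is a generator that involves only `b` and `c`
  by_cases hX : ∃ x : M, z₁ = (X ^ (0 + 1) : ℂ[X]) • x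
  swap
  · rw [Set.pair_comm]
    exact (h.swap₁₂.swap₂₃.string_or_splits_of_two_chains (n := 0) h5 (by omega) (by omega)
      (by omega) ⟨g₁, k₁, hz1⟩ (hzero _) hX (hzero _)).imp_right .inl
  obtain ⟨x, hx⟩ := hX
  rw [zero_add, pow_one] at hx
  obtain ⟨g₂, rfl⟩ := X_dvd_iff.2 (h.swap₁₂.coeff_zero_of_eq_X_smul (f := g₁) (g := 0) (k := k₁)
    (by omega) (by rw [← hx, hz1]; module))
  obtain ⟨k₂, rfl⟩ := X_dvd_iff.2 (h.swap₁₃.coeff_zero_of_eq_X_smul (f := k₁) (g := X * g₂) (k := 0)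
    (by omega) (by rw [← hx, hz1]; module))
  clear hx x hz
  -- subtracting a multiple of `X w` leaves only the term of degree one in `b`
  obtain ⟨g₃, t, rfl⟩ : ∃ (g₃ : ℂ[X]) (t : ℂ), g₂ = X * g₃ + C t :=
    ⟨g₂.divX, g₂.coeff 0, (X_mul_divX_add g₂).symm⟩
  rw [span_pair_add_smul w z₁ (-(X * g₃))] at hcyc ⊢
  have hz2 : z₁ + -(X * g₃) • w = (C t * X) • b + (X * (k₂ - X ^ 2 * g₃)) • c := by
    rw [hz1, hw]
    linear_combination (norm := module) -g₃ • ha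
  generalize z₁ + -(X * g₃) • w = z₂ at hcyc hz2 ⊢
  generalize k₂ - X ^ 2 * g₃ = k₃ at hz2
  by_cases ht : t = 0
  swap
  -- a combination of `w` and `z₂` involves only `a` and `c`
  · have hC : (C t⁻¹ * C t : ℂ[X]) = 1 := by rw [← C_mul, inv_mul_cancel₀ ht, C_1]
    have hw2 : w - C t⁻¹ • z₂ = (1 : ℂ[X]) • a + (X ^ 2 - C t⁻¹ * (X * k₃)) • c := by
      have : (C t⁻¹ * C t * X : ℂ[X]) • b = (X : ℂ[X]) • b := by rw [hC, one_mul]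
      rw [hw, hz2]
      linear_combination (norm := module) -this
    rw [span_pair_eq_of_mem (y' := w - C t⁻¹ • z₂) (z' := z₂) ⟨1, -C t⁻¹, by module⟩
      ⟨0, 1, by module⟩ ⟨1, C t⁻¹, by module⟩ ⟨0, 1, by module⟩]
    refine (h.swap₂₃.string_or_splits_of_two_chains (n := 0) h5 (by omega) (by omega)
      (by omega) ⟨_, _, hw2⟩ (hzero _) ?_ (hzero _)).imp_right .inl
    rintro ⟨x, hx⟩
    have := h.swap₂₃.coeff_zero_of_eq_X_smul (f := 1) (g := X ^ 2 - C t⁻¹ * (X * k₃))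
      (k := 0) (x := x) (by omega)
      (by rw [zero_smul, add_zero, ← hw2, hx, zero_add, pow_one])
    simp at this
  subst ht
  rw [C_0, zero_mul, zero_smul, zero_add, mul_smul] at hz2
  rcases h.swap₁₃.X_pow_smul_or 1 k₃ with h0 | ⟨j, hj, u, hu, huj⟩
  · rw [pow_one, ← hz2] at h0
    exact absurd (by rw [h0, Set.pair_comm, Submodule.span_insert_zero]) (hcyc w)
  rw [pow_one, ← hz2, add_comm] at huj
  obtain ⟨v, -, hv⟩ := exists_inverse hu 4
  have hinv : (v * u) • (X ^ (j + 1) : ℂ[X]) • c = (X ^ (j + 1) : ℂ[X]) • c := by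
    have := smul_eq_zero_of_dvd hv (h5 ((X ^ (j + 1) : ℂ[X]) • c))
    rwa [sub_smul, one_smul, sub_eq_zero] at this
  have hspan : Submodule.span ℂ[X] {w, z₂}
      = Submodule.span ℂ[X] {w, (X ^ (j + 1) : ℂ[X]) • c} :=
    span_pair_eq_of_mem ⟨1, 0, by module⟩
      ⟨0, v, by rw [huj]; linear_combination (norm := module) -hinv⟩ ⟨1, 0, by module⟩
      ⟨0, u, by rw [huj]; module⟩
  rw [hspan] at hcyc ⊢
  clear hspan hinv huj hz2
  have hsplit : ∀ i : ℕ, (X ^ 2 : ℂ[X]) • c = (X ^ i : ℂ[X]) • (X ^ (j + 1) : ℂ[X]) • c →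
      IsDecomposable (Submodule.span ℂ[X] {w, (X ^ (j + 1) : ℂ[X]) • c}) := fun i hi => by
    rw [span_pair_add_smul' w _ (-X ^ i), hw, hi]
    exact h.swap₁₃.splits (by omega) (by omega) (.inr ⟨X, 1, by module⟩) (.inl ⟨_, rfl⟩)
  have hj4 : j < 4 := by omega
  interval_cases j
  · exact .inl (hsplit 1 (by module))
  · exact .inl (hsplit 0 (by module))
  · refine .inr (.inr ⟨a, b, c, h, span_pair_eq_of_mem ⟨X, -1, ?_⟩ ⟨1, 0, ?_⟩ ⟨0, 1, ?_⟩
      ⟨-1, X, ?_⟩⟩)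
    · rw [hw]; linear_combination (norm := module) -ha
    · rw [hw]; module
    · rw [hw]; module
    · linear_combination (norm := module) -ha
  · -- here `X ^ 4 c = X ^ 2 w`, so that `w` alone generates
    exfalso
    apply hcyc w
    have : (X ^ (3 + 1) : ℂ[X]) • c = (X ^ 2 : ℂ[X]) • w := by
      rw [hw]; linear_combination (norm := module) -(X : ℂ[X]) • ha - hb
    rw [this]
    apply le_antisymm
    · rw [Submodule.span_le]
      rintro x (rfl | rfl)
      · exact Submodule.mem_span_singleton_self _
      · exact Submodule.smul_mem _ _ (Submodule.mem_span_singleton_self _)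
    · exact Submodule.span_mono (by simp)

/-- The normal form when all three chains occur in the first generator. -/
theorem splits_or_of_three_chains_aux (h : IsJordanTriple μ ν σ a b c)
    (h5 : ∀ x : M, (X ^ 5 : ℂ[X]) • x = 0) (hμ : 0 < μ) (hν : 0 < ν) (hσ : 0 < σ) {i j : ℕ}
    (hij : i ≤ j)
    (hj : n + j < σ) (hw : w = (X ^ n : ℂ[X]) • (a + (X ^ i : ℂ[X]) • b + (X ^ j : ℂ[X]) • c))
    (hw' : ¬ ∃ x : M, w = (X ^ (n + 1) : ℂ[X]) • x) (hz : ∃ x : M, z = (X ^ n : ℂ[X]) • x)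
    (hcyc : ∀ x : M, Submodule.span ℂ[X] {w, z} ≠ Submodule.span ℂ[X] {x}) :
    IsDecomposable (Submodule.span ℂ[X] {w, z}) ∨ HasStringForm (Submodule.span ℂ[X] {w, z}) ∨
      HasTripodForm (Submodule.span ℂ[X] {w, z}) := by
  have hwn : ∃ x : M, w = (X ^ n : ℂ[X]) • x := ⟨_, hw⟩
  by_cases h1 : ν ≤ μ + i
  · exact ((h.add_pow_smul h1).swap₂₃.string_or_splits_of_two_chains h5 hμ hσ hν
      ⟨X ^ n, X ^ (n + j), by rw [hw]; module⟩ hwn hw' hz).imp_right .inl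
  by_cases h2 : σ ≤ μ + j
  · exact ((h.swap₂₃.add_pow_smul h2).swap₂₃.string_or_splits_of_two_chains h5 hμ hν hσ
      ⟨X ^ n, X ^ (n + i), by rw [hw]; module⟩ hwn hw' hz).imp_right .inl
  rcases Nat.eq_zero_or_pos i with rfl | hi
  · exact ((h.swap₁₂.add_pow_smul (n := 0) (by omega)).swap₂₃.string_or_splits_of_two_chains h5
      hν hσ hμ ⟨X ^ n, X ^ (n + j), by rw [hw]; module⟩ hwn hw' hz).imp_right .inl
  obtain ⟨d, rfl⟩ := Nat.exists_eq_add_of_le hij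
  by_cases h3 : σ ≤ ν + d
  · exact ((h.swap₁₂.swap₂₃.add_pow_smul h3).swap₂₃.swap₁₂.string_or_splits_of_two_chains h5
      hμ hν hσ ⟨X ^ n, X ^ (n + i), by rw [hw]; module⟩ hwn hw' hz).imp_right .inl
  rcases Nat.eq_zero_or_pos d with rfl | hd
  · exact ((h.swap₁₃.add_pow_smul (n := 0) (by omega)).swap₂₃.swap₁₂.string_or_splits_of_two_chains h5
      hμ hσ hν ⟨X ^ n, X ^ (n + i), by rw [hw]; module⟩ hwn hw' hz).imp_right .inl
  have hn : n < μ := by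
    by_contra! hn
    obtain ⟨e, rfl⟩ := Nat.exists_eq_add_of_lt hi
    apply hw'
    have ha : (X ^ n : ℂ[X]) • a = 0 := (h.smul_eq_zero_iff _).2 (pow_dvd_pow X hn)
    rw [hw]
    exact ⟨(X ^ e : ℂ[X]) • b + (X ^ (e + d) : ℂ[X]) • c,
      by linear_combination (norm := module) ha⟩
  have hσ5 := h.swap₁₃.le_five h5
  obtain rfl : n = 0 := by omega
  obtain rfl : i = 1 := by omega
  obtain rfl : d = 1 := by omega
  obtain rfl : μ = 1 := by omega
  obtain rfl : ν = 3 := by omega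
  obtain rfl : σ = 5 := by omega
  exact h.splits_or_of_tripod h5 (by rw [hw]; module) hcyc

/-- The normal form when the leading coefficient of the first generator at `a` is nonzero. -/
theorem splits_or_of_unit (h : IsJordanTriple μ ν σ a b c)
    (h5 : ∀ x : M, (X ^ 5 : ℂ[X]) • x = 0) (hμ : 0 < μ) (hν : 0 < ν) (hσ : 0 < σ) {f g k : ℂ[X]}
    (hf : f.coeff 0 ≠ 0) (hw : w = (X ^ n : ℂ[X]) • (f • a + g • b + k • c))
    (hw' : ¬ ∃ x : M, w = (X ^ (n + 1) : ℂ[X]) • x) (hz : ∃ x : M, z = (X ^ n : ℂ[X]) • x)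
    (hcyc : ∀ x : M, Submodule.span ℂ[X] {w, z} ≠ Submodule.span ℂ[X] {x}) :
    IsDecomposable (Submodule.span ℂ[X] {w, z}) ∨ HasStringForm (Submodule.span ℂ[X] {w, z}) ∨
      HasTripodForm (Submodule.span ℂ[X] {w, z}) := by
  have hwn : ∃ x : M, w = (X ^ n : ℂ[X]) • x := ⟨_, hw⟩
  rcases h.swap₁₂.X_pow_smul_or n g with h0 | ⟨i, hi, u, hu, hui⟩
  · exact (h.swap₂₃.string_or_splits_of_two_chains h5 hμ hσ hν ⟨X ^ n * f, X ^ n * k, by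
      rw [hw]; linear_combination (norm := module) h0⟩ hwn hw' hz).imp_right .inl
  rcases h.swap₁₃.X_pow_smul_or n k with h0 | ⟨j, hj, v, hv, hvj⟩
  · exact (h.string_or_splits_of_two_chains h5 hμ hν hσ ⟨X ^ n * f, X ^ n * g, by
      rw [hw]; linear_combination (norm := module) h0⟩ hwn hw' hz).imp_right .inl
  replace h := ((h.unit_smul hf).swap₁₂.unit_smul hu).swap₁₂.swap₁₃.unit_smul hv |>.swap₁₃
  rcases le_total i j with hij | hij
  · exact h.splits_or_of_three_chains_aux h5 hμ hν hσ hij hj (by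
      rw [hw]; linear_combination (norm := module) hui + hvj) hw' hz hcyc
  · exact h.swap₂₃.splits_or_of_three_chains_aux h5 hμ hσ hν hij hi (by
      rw [hw]; linear_combination (norm := module) hui + hvj) hw' hz hcyc

theorem splits_or_of_height (h : IsJordanTriple μ ν σ a b c)
    (h5 : ∀ x : M, (X ^ 5 : ℂ[X]) • x = 0) (hμ : 0 < μ) (hν : 0 < ν) (hσ : 0 < σ)
    (hwn : ∃ x : M, w = (X ^ n : ℂ[X]) • x)
    (hw' : ¬ ∃ x : M, w = (X ^ (n + 1) : ℂ[X]) • x) (hz : ∃ x : M, z = (X ^ n : ℂ[X]) • x)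
    (hcyc : ∀ x : M, Submodule.span ℂ[X] {w, z} ≠ Submodule.span ℂ[X] {x}) :
    IsDecomposable (Submodule.span ℂ[X] {w, z}) ∨ HasStringForm (Submodule.span ℂ[X] {w, z}) ∨
      HasTripodForm (Submodule.span ℂ[X] {w, z}) := by
  obtain ⟨x, hw⟩ := hwn
  obtain ⟨f, g, k, rfl⟩ := h.generate x
  by_cases hf : f.coeff 0 = 0
  swap
  · exact h.splits_or_of_unit h5 hμ hν hσ hf hw hw' hz hcyc
  by_cases hg : g.coeff 0 = 0
  swap
  · exact h.swap₁₂.splits_or_of_unit h5 hν hμ hσ (g := f) (k := k) hg (by rw [hw]; module)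
      hw' hz hcyc
  by_cases hk : k.coeff 0 = 0
  swap
  · exact h.swap₁₃.splits_or_of_unit h5 hσ hν hμ (g := g) (k := f) hk (by rw [hw]; module)
      hw' hz hcyc
  obtain ⟨f, rfl⟩ := X_dvd_iff.2 hf
  obtain ⟨g, rfl⟩ := X_dvd_iff.2 hg
  obtain ⟨k, rfl⟩ := X_dvd_iff.2 hk
  exact absurd ⟨f • a + g • b + k • c, by rw [hw]; module⟩ hw'

/-- A noncyclic two-generated submodule of a module with three Jordan chains of length at most
five splits, is spanned by a string, or is in the tripod form. -/
theorem splits_or_hasStringForm_or_hasTripodForm (h : IsJordanTriple μ ν σ a b c)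
    (h5 : ∀ x : M, (X ^ 5 : ℂ[X]) • x = 0) (hμ : 0 < μ) (hν : 0 < ν) (hσ : 0 < σ)
    (hcyc : ∀ x : M, Submodule.span ℂ[X] {w, z} ≠ Submodule.span ℂ[X] {x}) :
    IsDecomposable (Submodule.span ℂ[X] {w, z}) ∨ HasStringForm (Submodule.span ℂ[X] {w, z}) ∨
      HasTripodForm (Submodule.span ℂ[X] {w, z}) := by
  classical
  -- the least `n + 1` such that not both generators are divisible by `X ^ (n + 1)`
  have hex : ∃ n : ℕ, ¬ ((∃ x : M, w = (X ^ n : ℂ[X]) • x) ∧ ∃ x : M, z = (X ^ n : ℂ[X]) • x) := by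
    refine ⟨5, ?_⟩
    rintro ⟨⟨x, hx⟩, ⟨y, hy⟩⟩
    apply hcyc 0
    rw [hx, hy, h5, h5, Set.pair_eq_singleton]
  obtain ⟨n, hn⟩ : ∃ n, Nat.find hex = n + 1 := by
    refine Nat.exists_eq_succ_of_ne_zero fun h0 => ?_
    have := Nat.find_spec hex
    rw [h0] at this
    exact this ⟨⟨w, by simp⟩, ⟨z, by simp⟩⟩
  have h1 := Nat.find_spec hex
  rw [hn] at h1
  obtain ⟨hw, hz⟩ := not_not.1 (Nat.find_min hex (show n < Nat.find hex by omega))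
  by_cases hw' : ∃ x : M, w = (X ^ (n + 1) : ℂ[X]) • x
  · rw [Set.pair_comm] at hcyc ⊢
    exact h.splits_or_of_height h5 hμ hν hσ hz (fun hz' => h1 ⟨hw', hz'⟩) hw hcyc
  · exact h.splits_or_of_height h5 hμ hν hσ hw hw' hz hcyc

end IsJordanTriple

end Tripods

section JordanBases

/-! ### Existence and invariants of Jordan bases -/

variable {ι : Type*} [Fintype ι] {N : Type*} [AddCommGroup N] [Module ℂ[X] N]

theorem C_smul_eq {N : Type*} [AddCommGroup N] [Module ℂ[X] N] [Module ℂ N]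
    [IsScalarTower ℂ ℂ[X] N] (t : ℂ) (x : N) : (C t : ℂ[X]) • x = t • x := by
  rw [← Polynomial.algebraMap_eq, algebraMap_smul]

/-- The family `e` generates Jordan chains of lengths `m i` of which the `ℂ[X]`-module `N` is the
direct sum. The lengths may be zero. -/
structure IsJordanBasis (m : ι → ℕ) (e : ι → N) : Prop where
  generate : ∀ x : N, ∃ f : ι → ℂ[X], x = ∑ i, f i • e i
  relation : ∀ f : ι → ℂ[X], ∑ i, f i • e i = 0 ↔ ∀ i, X ^ m i ∣ f i

theorem isJordanBasis_fin_three {μ ν σ : ℕ} {a b c : N} :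
    IsJordanBasis ![μ, ν, σ] ![a, b, c] ↔ IsJordanTriple μ ν σ a b c := by
  constructor
  · intro h
    refine ⟨fun x => ?_, fun f g k => ?_⟩
    · obtain ⟨f, hf⟩ := h.generate x
      exact ⟨f 0, f 1, f 2, by simpa [Fin.sum_univ_three] using hf⟩
    · simpa [Fin.sum_univ_three, Fin.forall_fin_succ] using h.relation ![f, g, k]
  · intro h
    refine ⟨fun x => ?_, fun f => ?_⟩
    · obtain ⟨f, g, k, hf⟩ := h.generate x
      exact ⟨![f, g, k], by simpa [Fin.sum_univ_three] using hf⟩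
    · simpa [Fin.sum_univ_three, Fin.forall_fin_succ] using h.relation (f 0) (f 1) (f 2)

namespace IsJordanBasis

variable {m : ι → ℕ} {e : ι → N}

/-- Two modules having Jordan bases with the same chain lengths are isomorphic, by an isomorphism
that matches the bases. -/
theorem exists_equiv (h : IsJordanBasis m e) {N' : Type*} [AddCommGroup N'] [Module ℂ[X] N']
    {e' : ι → N'} (h' : IsJordanBasis m e') : ∃ φ : N ≃ₗ[ℂ[X]] N', ∀ i, φ (e i) = e' i := by
  classical
  have hs : Function.Surjective (Fintype.linearCombination ℂ[X] e) := fun x => by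
    obtain ⟨f, rfl⟩ := h.generate x
    exact ⟨f, Fintype.linearCombination_apply _ _ _⟩
  have hs' : Function.Surjective (Fintype.linearCombination ℂ[X] e') := fun x => by
    obtain ⟨f, rfl⟩ := h'.generate x
    exact ⟨f, Fintype.linearCombination_apply _ _ _⟩
  have hk : LinearMap.ker (Fintype.linearCombination ℂ[X] e)
      = LinearMap.ker (Fintype.linearCombination ℂ[X] e') := by
    ext f
    rw [LinearMap.mem_ker, LinearMap.mem_ker, Fintype.linearCombination_apply,
      Fintype.linearCombination_apply, h.relation, h'.relation]
  refine ⟨(LinearMap.quotKerEquivOfSurjective _ hs).symm ≪≫ₗ Submodule.quotEquivOfEq _ _ hk ≪≫ₗ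
    LinearMap.quotKerEquivOfSurjective _ hs', fun i => ?_⟩
  have h1 : Fintype.linearCombination ℂ[X] e (Pi.single i 1) = e i := by simp
  have h2 : (LinearMap.quotKerEquivOfSurjective _ hs).symm (e i)
      = Submodule.Quotient.mk (Pi.single i 1) := by
    rw [LinearEquiv.symm_apply_eq]
    exact h1.symm
  rw [LinearEquiv.trans_apply, LinearEquiv.trans_apply, h2, Submodule.quotEquivOfEq_mk]
  change Fintype.linearCombination ℂ[X] e' (Pi.single i 1) = e' i
  simp

theorem reindex {κ : Type*} [Fintype κ] (h : IsJordanBasis m e) (g : κ ≃ ι) :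
    IsJordanBasis (m ∘ g) (e ∘ g) where
  generate x := by
    obtain ⟨f, rfl⟩ := h.generate x
    exact ⟨f ∘ g, (g.sum_comp fun i => f i • e i).symm⟩
  relation f := by
    have := h.relation (f ∘ g.symm)
    rw [← g.sum_comp] at this
    simp only [Function.comp_apply, Equiv.symm_apply_apply] at this ⊢
    rw [this, ← g.forall_congr_right]
    simp

/-- The chains of length zero may be dropped. -/
theorem subtype_ne_zero (h : IsJordanBasis m e) :
    IsJordanBasis (fun i : {i // m i ≠ 0} => m i) (fun i => e i) := by
  classical
  have h0 : ∀ i, m i = 0 → e i = 0 := fun i hi => by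
    have := (h.relation (Pi.single i 1)).2 fun j => by
      by_cases hj : j = i
      · subst hj; simp [hi]
      · simp [hj]
    simpa [Pi.single_apply] using this
  have hsum : ∀ f : ι → ℂ[X], ∑ i, f i • e i = ∑ i : {i // m i ≠ 0}, f i • e i := fun f => by
    rw [← Finset.sum_filter_of_ne (p := fun i => m i ≠ 0)
      (fun i _ hi h1 => hi (by rw [h0 i h1, smul_zero]))]
    exact Finset.sum_subtype _ (by simp) _
  refine ⟨fun x => ?_, fun f => ?_⟩
  · obtain ⟨f, rfl⟩ := h.generate x
    exact ⟨fun i => f i, hsum f⟩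
  · have := h.relation (fun i => if hi : m i ≠ 0 then f ⟨i, hi⟩ else 0)
    rw [hsum] at this
    rw [show ∑ i, f i • e i = ∑ i : {i // m i ≠ 0},
      (if hi : m i ≠ 0 then f ⟨i, hi⟩ else 0) • e i from
      Finset.sum_congr rfl fun i _ => by simp [i.2], this]
    constructor
    · intro hd i
      simpa [i.2] using hd i
    · intro hd i
      by_cases hi : m i = 0
      · simp [hi]
      · simpa [hi] using hd ⟨i, hi⟩

variable [Module ℂ N] [IsScalarTower ℂ ℂ[X] N]

theorem finrank_torsionBy_X (h : IsJordanBasis m e) (hm : ∀ i, 0 < m i) :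
    Module.finrank ℂ (Submodule.torsionBy ℂ[X] N X) = Fintype.card ι := by
  classical
  have hX : ∀ (i : ι) (t : ℂ), (X : ℂ[X]) * (C t * X ^ (m i - 1)) = C t * X ^ m i := fun i t => by
    conv_rhs => rw [← Nat.sub_add_cancel (hm i)]
    ring
  let φ : (ι → ℂ) →ₗ[ℂ] Submodule.torsionBy ℂ[X] N X :=
    { toFun := fun c => ⟨∑ i, (C (c i) * X ^ (m i - 1)) • e i, by
        rw [Submodule.mem_torsionBy_iff, Finset.smul_sum]
        simp only [smul_smul, hX]
        exact (h.relation _).2 fun i => Dvd.intro_left _ rfl⟩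
      map_add' := fun c d => by
        ext
        simp [add_mul, add_smul, Finset.sum_add_distrib]
      map_smul' := fun t c => by
        ext
        simp only [Pi.smul_apply, smul_eq_mul, C_mul, mul_assoc, mul_smul, C_smul_eq,
          Finset.smul_sum, RingHom.id_apply, Submodule.coe_smul_of_tower] }
  have hinj : Function.Injective φ := by
    rw [injective_iff_map_eq_zero]
    intro c hc
    have h1 := (h.relation fun i => C (c i) * X ^ (m i - 1)).1 (congrArg Subtype.val hc)
    funext i
    have h2 := X_pow_dvd_iff.1 (h1 i) (m i - 1) (Nat.sub_lt (hm i) one_pos)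
    simpa using h2
  have hsurj : Function.Surjective φ := by
    rintro ⟨x, hx⟩
    obtain ⟨f, rfl⟩ := h.generate x
    rw [Submodule.mem_torsionBy_iff, Finset.smul_sum] at hx
    simp only [smul_smul] at hx
    have h1 := (h.relation _).1 hx
    refine ⟨fun i => (f i).coeff (m i - 1), Subtype.ext ?_⟩
    change ∑ i, (C ((f i).coeff (m i - 1)) * X ^ (m i - 1)) • e i = _
    rw [← sub_eq_zero, ← Finset.sum_sub_distrib]
    simp only [← sub_smul]
    refine (h.relation _).2 fun i => X_pow_dvd_iff.2 fun d hd => ?_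
    rcases (show d ≤ m i - 1 by omega).eq_or_lt with rfl | hlt
    · simp
    · have := X_pow_dvd_iff.1 (h1 i) (d + 1) (by omega)
      rw [coeff_X_mul] at this
      simp [this, coeff_X_pow, hlt.ne]
  rw [← (LinearEquiv.ofBijective φ ⟨hinj, hsurj⟩).finrank_eq, Module.finrank_fintype_fun_eq_card]

theorem finrank_eq_sum (h : IsJordanBasis m e) : Module.finrank ℂ N = ∑ i, m i := by
  classical
  let φ : ((i : ι) → Fin (m i) → ℂ) →ₗ[ℂ] N :=
    { toFun := fun x => ∑ i, (∑ j : Fin (m i), C (x i j) * X ^ (j : ℕ) : ℂ[X]) • e i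
      map_add' := fun c d => by
        simp [add_mul, add_smul, Finset.sum_add_distrib]
      map_smul' := fun t c => by
        simp only [Pi.smul_apply, smul_eq_mul, C_mul, mul_assoc, ← Finset.mul_sum, mul_smul,
          C_smul_eq, Finset.smul_sum, RingHom.id_apply] }
  have hcoeff : ∀ (i : ι) (x : Fin (m i) → ℂ) (j : ℕ) (hj : j < m i),
      (∑ j : Fin (m i), C (x j) * X ^ (j : ℕ) : ℂ[X]).coeff j = x ⟨j, hj⟩ := fun i x j hj => by
    rw [finsetSum_coeff, Finset.sum_eq_single ⟨j, hj⟩]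
    · simp
    · intro k _ hk
      have : j ≠ k := fun hjk => hk (Fin.ext hjk.symm)
      simp [coeff_X_pow, this]
    · simp
  have hinj : Function.Injective φ := by
    rw [injective_iff_map_eq_zero]
    intro x hx
    have h1 := (h.relation _).1 hx
    funext i j
    rw [← hcoeff i (x i) j j.2]
    exact X_pow_dvd_iff.1 (h1 i) j j.2
  have hsurj : Function.Surjective φ := fun x => by
    obtain ⟨f, rfl⟩ := h.generate x
    refine ⟨fun i j => (f i).coeff j, ?_⟩
    change ∑ i, (∑ j : Fin (m i), C ((f i).coeff j) * X ^ (j : ℕ) : ℂ[X]) • e i = _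
    rw [← sub_eq_zero, ← Finset.sum_sub_distrib]
    simp only [← sub_smul]
    refine (h.relation _).2 fun i => X_pow_dvd_iff.2 fun d hd => ?_
    rw [coeff_sub, hcoeff i (fun j => (f i).coeff j) d hd, sub_self]
  rw [← (LinearEquiv.ofBijective φ ⟨hinj, hsurj⟩).finrank_eq, Module.finrank_pi_fintype]
  simp

end IsJordanBasis

/-- A finitely generated `ℂ[X]`-module killed by a power of `X` has a Jordan basis; the number of
chains is the dimension of the kernel of `X`. -/
theorem exists_isJordanBasis [Module ℂ N] [IsScalarTower ℂ ℂ[X] N] [Module.Finite ℂ[X] N] {n r : ℕ}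
    (hN : ∀ x : N, (X ^ n : ℂ[X]) • x = 0)
    (hr : Module.finrank ℂ (Submodule.torsionBy ℂ[X] N X) = r) :
    ∃ (m : Fin r → ℕ) (e : Fin r → N), (∀ i, 0 < m i) ∧ IsJordanBasis m e := by
  classical
  obtain ⟨d, k, ⟨φ⟩⟩ := Module.torsion_by_prime_power_decomposition (p := (X : ℂ[X]))
    (irreducible_X (R := ℂ)) (M := N) (fun x => ⟨⟨X ^ n, n, rfl⟩, hN x⟩)
  have h : IsJordanBasis k (fun i => φ.symm (DirectSum.lof ℂ[X] (Fin d)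
      (fun i => ℂ[X] ⧸ Submodule.span ℂ[X] {(X : ℂ[X]) ^ k i}) i (Submodule.Quotient.mk 1))) := by
    have hsum : ∀ (f : Fin d → ℂ[X]) (i : Fin d), φ (∑ i, f i • φ.symm (DirectSum.lof ℂ[X] (Fin d)
        (fun i => ℂ[X] ⧸ Submodule.span ℂ[X] {(X : ℂ[X]) ^ k i}) i (Submodule.Quotient.mk 1))) i
        = Submodule.Quotient.mk (f i) := fun f i => by
      simp only [map_sum, map_smul, LinearEquiv.apply_symm_apply]
      rw [DFinsupp.finsetSum_apply, Finset.sum_eq_single i]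
      · rw [DirectSum.smul_apply, DirectSum.lof_apply, ← Submodule.Quotient.mk_smul, smul_eq_mul,
          mul_one]
      · intro j _ hj
        rw [DirectSum.smul_apply, DirectSum.lof_eq_of, DirectSum.of_eq_of_ne _ _ _ hj.symm,
          smul_zero]
      · simp
    refine ⟨fun x => ?_, fun f => ?_⟩
    · choose f hf using fun i => Submodule.Quotient.mk_surjective _ (φ x i)
      refine ⟨f, φ.injective (DFinsupp.ext fun i => ?_)⟩
      rw [hsum, hf]
    · rw [← φ.map_eq_zero_iff, DFinsupp.ext_iff]
      refine forall_congr' fun i => ?_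
      rw [hsum, DirectSum.zero_apply, Submodule.Quotient.mk_eq_zero, Submodule.mem_span_singleton]
      simp only [dvd_def, smul_eq_mul, mul_comm, eq_comm]
  replace h := h.subtype_ne_zero
  have hcard := h.finrank_torsionBy_X fun i => Nat.pos_of_ne_zero i.2
  rw [hr] at hcard
  exact ⟨_, _, fun i => Nat.pos_of_ne_zero (Subtype.prop (p := fun i => k i ≠ 0) _),
    h.reindex (finCongr hcard |>.trans (Fintype.equivFin _).symm)⟩

end JordanBases

/-! ### Triples as modules over the polynomial ring -/

/-- A `T`-invariant subspace, as a `ℂ[X]`-submodule of the module on which `X` acts as `T`. -/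
noncomputable def polySubmodule {V : Type*} [AddCommGroup V] [Module ℂ V] (T : V →ₗ[ℂ] V)
    (W : Submodule ℂ V) (hW : ∀ x ∈ W, T x ∈ W) : Submodule ℂ[X] (Module.AEval' T) :=
  Module.AEval.mapSubmodule ℂ V T ⟨W, hW⟩

section

variable {V : Type*} [AddCommGroup V] [Module ℂ V] {T : V →ₗ[ℂ] V}

theorem mem_polySubmodule {W : Submodule ℂ V} {hW : ∀ x ∈ W, T x ∈ W} {x : Module.AEval' T} :
    x ∈ polySubmodule T W hW ↔ (Module.AEval'.of T).symm x ∈ W :=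
  Module.AEval.mem_mapSubmodule_apply ℂ V T

theorem of_mem_polySubmodule {W : Submodule ℂ V} {hW : ∀ x ∈ W, T x ∈ W} {x : V} :
    Module.AEval'.of T x ∈ polySubmodule T W hW ↔ x ∈ W := by
  rw [mem_polySubmodule, LinearEquiv.symm_apply_apply]

/-- The underlying `T`-invariant subspace of a `ℂ[X]`-submodule. -/
noncomputable def underlying (P : Submodule ℂ[X] (Module.AEval' T)) : Submodule ℂ V :=
  (P.restrictScalars ℂ).comap (Module.AEval'.of T).toLinearMap

theorem mem_underlying {P : Submodule ℂ[X] (Module.AEval' T)} {x : V} :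
    x ∈ underlying P ↔ Module.AEval'.of T x ∈ P := Iff.rfl

theorem underlying_invariant (P : Submodule ℂ[X] (Module.AEval' T)) :
    ∀ x ∈ underlying P, T x ∈ underlying P := fun x hx => by
  rw [mem_underlying, ← Module.AEval'.X_smul_of]
  exact P.smul_mem _ hx

theorem polySubmodule_vectT (S : Set V) :
    polySubmodule T (vectT T S) (vectT_invariant T S)
      = Submodule.span ℂ[X] (Module.AEval'.of T '' S) := by
  apply le_antisymm
  · intro x hx
    rw [mem_polySubmodule] at hx
    suffices h : vectT T S ≤ underlying (Submodule.span ℂ[X] (Module.AEval'.of T '' S)) by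
      have := h hx
      rwa [mem_underlying, LinearEquiv.apply_symm_apply] at this
    refine Submodule.span_le.2 ?_
    rintro _ ⟨y, hy, k, rfl⟩
    change Module.AEval'.of T ((T ^ k) y) ∈ _
    have := Module.AEval'.X_pow_smul_of T y k
    rw [Module.End.smul_def] at this
    rw [← this]
    exact Submodule.smul_mem (Submodule.span ℂ[X] (Module.AEval'.of T '' S)) _
      (Submodule.subset_span ⟨y, hy, rfl⟩)
  · rw [Submodule.span_le]
    rintro _ ⟨y, hy, rfl⟩
    exact of_mem_polySubmodule.2 (Submodule.subset_span ⟨y, hy, 0, by simp⟩)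

end

namespace InvTriple

/-- The subspace of a triple, as a `ℂ[X]`-submodule. -/
noncomputable abbrev polySub (A : InvTriple.{u}) : Submodule ℂ[X] (Module.AEval' A.T) :=
  polySubmodule A.T A.U A.invariant

theorem not_indecomposable_of_splits {A : InvTriple.{u}} (h : IsDecomposable A.polySub) :
    ¬ A.Indecomposable := by
  obtain ⟨P, Q, hPQ, hP, hQ, hU⟩ := h
  intro hA
  have hbot : ∀ P : Submodule ℂ[X] (Module.AEval' A.T), underlying P = ⊥ → P = ⊥ := fun P h => by
    rw [eq_bot_iff]
    intro x hx
    have : (Module.AEval'.of A.T).symm x ∈ underlying P := by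
      rwa [mem_underlying, LinearEquiv.apply_symm_apply]
    rw [h, Submodule.mem_bot] at this
    simpa using this
  refine (hA _ _ (underlying_invariant P) (underlying_invariant Q) ⟨?_, ?_⟩ ?_).elim
    (fun h => hP (hbot _ h)) (fun h => hQ (hbot _ h))
  · rw [Submodule.disjoint_def]
    intro x hx hx'
    exact (Module.AEval'.of A.T).map_eq_zero_iff.1 (Submodule.disjoint_def.1 hPQ.1 _ hx hx')
  · rw [codisjoint_iff, eq_top_iff]
    rintro x -
    have : Module.AEval'.of A.T x ∈ P ⊔ Q := by rw [hPQ.sup_eq_top]; trivial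
    obtain ⟨p, hp, q, hq, hpq⟩ := Submodule.mem_sup.1 this
    refine Submodule.mem_sup.2 ⟨(Module.AEval'.of A.T).symm p, ?_, (Module.AEval'.of A.T).symm q,
      ?_, ?_⟩
    · rwa [mem_underlying, LinearEquiv.apply_symm_apply]
    · rwa [mem_underlying, LinearEquiv.apply_symm_apply]
    · rw [← map_add, hpq, LinearEquiv.symm_apply_apply]
  · apply le_antisymm
    · intro x hx
      have : Module.AEval'.of A.T x ∈ A.polySub := of_mem_polySubmodule.2 hx
      rw [hU] at this
      obtain ⟨p, ⟨hpU, hp⟩, q, ⟨hqU, hq⟩, hpq⟩ := Submodule.mem_sup.1 this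
      refine Submodule.mem_sup.2 ⟨(Module.AEval'.of A.T).symm p, ⟨mem_polySubmodule.1 hpU, ?_⟩,
        (Module.AEval'.of A.T).symm q, ⟨mem_polySubmodule.1 hqU, ?_⟩, ?_⟩
      · change _ ∈ underlying P
        rwa [mem_underlying, LinearEquiv.apply_symm_apply]
      · change _ ∈ underlying Q
        rwa [mem_underlying, LinearEquiv.apply_symm_apply]
      · rw [← map_add, hpq, LinearEquiv.symm_apply_apply]
    · exact sup_le inf_le_left inf_le_left

/-- A triple is indecomposable as soon as every idempotent `ℂ[X]`-linear endomorphism preserving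
its subspace is `0` or `1`. -/
theorem indecomposable_of_idempotents {A : InvTriple.{u}}
    (h : ∀ E : Module.AEval' A.T →ₗ[ℂ[X]] Module.AEval' A.T, (∀ x, E (E x) = E x) →
      (∀ x ∈ A.polySub, E x ∈ A.polySub) → (∀ x, E x = 0) ∨ ∀ x, E x = x) :
    A.Indecomposable := by
  intro V' V'' h' h'' hc hU
  have hP : IsCompl (polySubmodule A.T V' h') (polySubmodule A.T V'' h'') := by
    constructor
    · rw [Submodule.disjoint_def]
      intro x hx hx'
      have := Submodule.disjoint_def.1 hc.1 _ (mem_polySubmodule.1 hx) (mem_polySubmodule.1 hx')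
      simpa using this
    · rw [codisjoint_iff, eq_top_iff]
      rintro x -
      have : (Module.AEval'.of A.T).symm x ∈ V' ⊔ V'' := by rw [hc.sup_eq_top]; trivial
      obtain ⟨p, hp, q, hq, hpq⟩ := Submodule.mem_sup.1 this
      refine Submodule.mem_sup.2 ⟨Module.AEval'.of A.T p, of_mem_polySubmodule.2 hp,
        Module.AEval'.of A.T q, of_mem_polySubmodule.2 hq, ?_⟩
      rw [← map_add, hpq, LinearEquiv.apply_symm_apply]
  have hleft : ∀ p ∈ V',
      (Submodule.projection _ _ hP) (Module.AEval'.of A.T p) = Module.AEval'.of A.T p :=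
    fun _ hp => Submodule.projection_apply_of_mem_left hP (of_mem_polySubmodule.2 hp)
  have hright : ∀ q ∈ V'', (Submodule.projection _ _ hP) (Module.AEval'.of A.T q) = 0 :=
    fun q hq => Submodule.projection_apply_of_mem_right hP (of_mem_polySubmodule.2 hq)
  have hpres : ∀ x ∈ A.polySub, Submodule.projection _ _ hP x ∈ A.polySub := by
    intro x hx
    rw [mem_polySubmodule] at hx ⊢
    rw [hU] at hx
    obtain ⟨p, hp, q, hq, hpq⟩ := Submodule.mem_sup.1 hx
    have : x = Module.AEval'.of A.T p + Module.AEval'.of A.T q := by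
      rw [← map_add, hpq, LinearEquiv.apply_symm_apply]
    rw [this, map_add, hleft p hp.2, hright q hq.2, add_zero, LinearEquiv.symm_apply_apply]
    exact hp.1
  rcases h (Submodule.projection _ _ hP) (fun x => Submodule.projection_apply_of_mem_left hP
    (Submodule.projection_apply_mem hP x)) hpres with h0 | h1
  · left
    rw [eq_bot_iff]
    intro p hp
    have := hleft p hp
    rw [h0] at this
    simpa using this.symm
  · right
    rw [eq_bot_iff]
    intro q hq
    have := hright q hq
    rw [h1] at this
    simpa using this

theorem similar_of_equiv {A : InvTriple.{u}} {B : InvTriple.{v}}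
    (φ : Module.AEval' A.T ≃ₗ[ℂ[X]] Module.AEval' B.T)
    (h : A.polySub.map φ.toLinearMap = B.polySub) : Similar A B := by
  refine ⟨Module.AEval'.of A.T ≪≫ₗ φ.restrictScalars ℂ ≪≫ₗ (Module.AEval'.of B.T).symm, ?_, ?_⟩
  · ext y
    rw [← of_mem_polySubmodule (hW := B.invariant)]
    change _ ↔ Module.AEval'.of B.T y ∈ B.polySub
    rw [← h]
    constructor
    · rintro ⟨x, hx, rfl⟩
      exact ⟨Module.AEval'.of A.T x, of_mem_polySubmodule.2 hx, by simp⟩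
    · rintro ⟨x, hx, hxy⟩
      refine ⟨(Module.AEval'.of A.T).symm x, mem_polySubmodule.1 hx, ?_⟩
      have hxy' : φ x = Module.AEval'.of B.T y := hxy
      simp [hxy']
  · intro x
    simp [← Module.AEval'.X_smul_of]

theorem nV_eq (A : InvTriple.{u}) :
    A.nV = Module.finrank ℂ (Submodule.torsionBy ℂ[X] (Module.AEval' A.T) X) := by
  refine LinearEquiv.finrank_eq
    { toFun := fun x => ⟨Module.AEval'.of A.T x, ?_⟩
      invFun := fun x => ⟨(Module.AEval'.of A.T).symm x, ?_⟩
      map_add' := fun _ _ => rfl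
      map_smul' := fun _ _ => rfl
      left_inv := fun _ => rfl
      right_inv := fun _ => rfl }
  · rw [Submodule.mem_torsionBy_iff, Module.AEval'.X_smul_of, x.2, map_zero]
  · rw [LinearMap.mem_ker, ← Module.AEval'.of_symm_X_smul, (Submodule.mem_torsionBy_iff _ _).1 x.2,
      map_zero]

theorem nU_eq (A : InvTriple.{u}) :
    A.nU = Module.finrank ℂ (Submodule.torsionBy ℂ[X] A.polySub X) := by
  refine LinearEquiv.finrank_eq
    { toFun := fun x => ⟨⟨Module.AEval'.of A.T x.1, of_mem_polySubmodule.2 x.1.2⟩, ?_⟩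
      invFun := fun x => ⟨⟨(Module.AEval'.of A.T).symm x.1, mem_polySubmodule.1 x.1.2⟩, ?_⟩
      map_add' := fun _ _ => rfl
      map_smul' := fun _ _ => rfl
      left_inv := fun _ => rfl
      right_inv := fun _ => rfl }
  · have := LinearMap.mem_ker.1 x.2
    rw [LinearMap.domRestrict_apply] at this
    rw [Submodule.mem_torsionBy_iff, Subtype.ext_iff]
    change (X : ℂ[X]) • Module.AEval'.of A.T x.1 = 0
    rw [Module.AEval'.X_smul_of, this, map_zero]
  · have := (Submodule.mem_torsionBy_iff _ _).1 x.2
    rw [Subtype.ext_iff] at this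
    change (X : ℂ[X]) • x.1.1 = 0 at this
    rw [LinearMap.mem_ker, LinearMap.domRestrict_apply]
    rw [← Module.AEval'.of_symm_X_smul, this, map_zero]

theorem finrank_U_eq (A : InvTriple.{u}) : Module.finrank ℂ A.U = Module.finrank ℂ A.polySub :=
  LinearEquiv.finrank_eq
    { toFun := fun x => ⟨Module.AEval'.of A.T x.1, of_mem_polySubmodule.2 x.2⟩
      invFun := fun x => ⟨(Module.AEval'.of A.T).symm x.1, mem_polySubmodule.1 x.2⟩
      map_add' := fun _ _ => rfl
      map_smul' := fun _ _ => rfl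
      left_inv := fun _ => rfl
      right_inv := fun _ => rfl }

end InvTriple

/-! ### The eight normal forms -/

/-- The lengths of the three Jordan chains in the eight normal forms. -/
def chainLengths : Fin 8 → ℕ × ℕ × ℕ :=
  ![(1, 3, 5), (2, 3, 5), (2, 3, 5), (1, 3, 5), (2, 4, 5), (2, 5, 5), (2, 4, 5), (1, 3, 5)]

section

variable {N : Type*} [AddCommGroup N] [Module ℂ[X] N]

/-- The two generators of the submodule in the eight normal forms, in terms of generators
`a`, `b`, `c` of the Jordan chains. -/
noncomputable def formGens (a b c : N) : Fin 8 → N × N :=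
  ![((X ^ 2 : ℂ[X]) • b, (X ^ 2 : ℂ[X]) • c + (X : ℂ[X]) • b + a),
    ((X : ℂ[X]) • b, (X : ℂ[X]) • c + b + a),
    ((X : ℂ[X]) • a, (X ^ 2 : ℂ[X]) • c + (X : ℂ[X]) • b + a),
    (a + (X : ℂ[X]) • b, (X ^ 2 : ℂ[X]) • c + a),
    ((X : ℂ[X]) • a + (X ^ 2 : ℂ[X]) • b, (X : ℂ[X]) • c + a),
    ((X : ℂ[X]) • a + (X ^ 3 : ℂ[X]) • b, (X : ℂ[X]) • c + a),
    (a + (X : ℂ[X]) • b, (X ^ 3 : ℂ[X]) • c + (X : ℂ[X]) • a),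
    (a + (X : ℂ[X]) • b, (X : ℂ[X]) • c + b)]

/-- The submodule `U` is in the `k`-th normal form with respect to some Jordan basis. -/
def HasForm (k : Fin 8) (U : Submodule ℂ[X] N) : Prop :=
  ∃ a b c : N, IsJordanTriple (chainLengths k).1 (chainLengths k).2.1 (chainLengths k).2.2 a b c ∧
    U = Submodule.span ℂ[X] {(formGens a b c k).1, (formGens a b c k).2}

theorem HasTripodForm.hasForm {U : Submodule ℂ[X] N} (h : HasTripodForm U) : HasForm 0 U := h

theorem HasStringForm.splits_or_hasForm {U : Submodule ℂ[X] N} (h : HasStringForm U)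
    (h5 : ∀ x : N, (X ^ 5 : ℂ[X]) • x = 0) : IsDecomposable U ∨ ∃ k, HasForm k U := by
  obtain ⟨α, β, γ, p, q, r, s, a, b, c, h, hp, hpq, hq, hgap, hpr, hr, hps, hs, rfl⟩ := h
  refine (h.string_splits_or (h.le_five h5) (h.swap₁₂.le_five h5) (h.swap₁₃.le_five h5) hp hpq hq
    hgap hpr hr hps hs).imp_right fun hmem => ?_
  simp only [List.mem_cons, List.cons.injEq, List.not_mem_nil, or_false, and_true] at hmem
  rcases hmem with ⟨rfl, rfl, rfl, rfl, rfl, rfl, rfl⟩ | ⟨rfl, rfl, rfl, rfl, rfl, rfl, rfl⟩ |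
    ⟨rfl, rfl, rfl, rfl, rfl, rfl, rfl⟩ | ⟨rfl, rfl, rfl, rfl, rfl, rfl, rfl⟩ |
    ⟨rfl, rfl, rfl, rfl, rfl, rfl, rfl⟩ | ⟨rfl, rfl, rfl, rfl, rfl, rfl, rfl⟩ |
    ⟨rfl, rfl, rfl, rfl, rfl, rfl, rfl⟩ | ⟨rfl, rfl, rfl, rfl, rfl, rfl, rfl⟩ |
    ⟨rfl, rfl, rfl, rfl, rfl, rfl, rfl⟩ | ⟨rfl, rfl, rfl, rfl, rfl, rfl, rfl⟩
  · refine ⟨7, a, b, c, h, span_pair_eq_of_mem ⟨1, 0, ?_⟩ ⟨0, 1, ?_⟩ ⟨1, 0, ?_⟩ ⟨0, 1, ?_⟩⟩ <;>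
    · simp only [formGens, Matrix.cons_val]
      module
  · refine ⟨7, -a, c, b, h.neg.swap₂₃, span_pair_eq_of_mem ⟨-1, X, ?_⟩ ⟨0, 1, ?_⟩ ⟨-1, X, ?_⟩
      ⟨0, 1, ?_⟩⟩ <;>
    · simp only [formGens, Matrix.cons_val]
      module
  · refine ⟨7, -c, a, b, h.swap₁₃.neg.swap₂₃, span_pair_eq_of_mem ⟨X, -1, ?_⟩ ⟨1, 0, ?_⟩ ⟨0, 1, ?_⟩
      ⟨-1, X, ?_⟩⟩ <;>
    · simp only [formGens, Matrix.cons_val]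
      module
  · refine ⟨3, a, b, -c, h.swap₁₃.neg.swap₁₃, span_pair_eq_of_mem ⟨1, 0, ?_⟩ ⟨1, -1, ?_⟩ ⟨1, 0, ?_⟩
      ⟨1, -1, ?_⟩⟩ <;>
    · simp only [formGens, Matrix.cons_val]
      module
  · refine ⟨3, a, -c, b, h.swap₁₃.neg.swap₁₃.swap₂₃, span_pair_eq_of_mem ⟨1, -1, ?_⟩ ⟨1, 0, ?_⟩
      ⟨0, 1, ?_⟩ ⟨-1, 1, ?_⟩⟩ <;>
    · simp only [formGens, Matrix.cons_val]
      module
  · refine ⟨6, a, b, -c, h.swap₁₃.neg.swap₁₃, span_pair_eq_of_mem ⟨1, 0, ?_⟩ ⟨X, -1, ?_⟩ ⟨1, 0, ?_⟩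
      ⟨X, -1, ?_⟩⟩ <;>
    · simp only [formGens, Matrix.cons_val]
      module
  · refine ⟨4, a, -c, b, h.swap₁₃.neg.swap₁₃.swap₂₃, span_pair_eq_of_mem ⟨X, -1, ?_⟩ ⟨1, 0, ?_⟩
      ⟨0, 1, ?_⟩ ⟨-1, X, ?_⟩⟩ <;>
    · simp only [formGens, Matrix.cons_val]
      module
  · refine ⟨5, a, -c, b, h.swap₁₃.neg.swap₁₃.swap₂₃, span_pair_eq_of_mem ⟨X, -1, ?_⟩ ⟨1, 0, ?_⟩
      ⟨0, 1, ?_⟩ ⟨-1, X, ?_⟩⟩ <;>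
    · simp only [formGens, Matrix.cons_val]
      module
  · refine ⟨2, a - (X ^ 1 : ℂ[X]) • c, c, b, (h.swap₂₃.sub_pow_smul (by norm_num)),
      span_pair_eq_of_mem ⟨X, -1, ?_⟩ ⟨1, 0, ?_⟩ ⟨0, 1, ?_⟩ ⟨-1, X, ?_⟩⟩ <;>
    · simp only [formGens, Matrix.cons_val]
      module
  · refine ⟨1, c, a - (X ^ 0 : ℂ[X]) • c, b,
      ((h.swap₂₃.sub_pow_smul (n := 0) (by norm_num)).swap₁₂), span_pair_eq_of_mem
      ⟨X, -1, ?_⟩ ⟨1, 0, ?_⟩ ⟨0, 1, ?_⟩ ⟨-1, X, ?_⟩⟩ <;>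
    · simp only [formGens, Matrix.cons_val]
      module

end

/-! ### Jordan bases of the model spaces -/

theorem jordanOp_pow_jordanGen (v : Fin 3 → ℕ) (i : Fin 3) (k : ℕ) (i' : Fin 3)
    (j : Fin (v i' + 1)) :
    ((jordanOp v ^ k) (jordanGen v i)) i' j = if i' = i ∧ (j : ℕ) = k then 1 else 0 := by
  induction k generalizing j with
  | zero =>
    by_cases hi : i' = i
    · subst hi
      by_cases hj : (j : ℕ) = 0
      · obtain rfl : j = 0 := Fin.ext hj
        simp [jordanGen]
      · have : j ≠ 0 := fun h => hj (by simp [h])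
        simp [jordanGen, this]
    · simp [jordanGen, hi]
  | succ k ih =>
    rw [pow_succ', Module.End.mul_apply]
    change (if (j : ℕ) = 0 then 0 else _) = _
    by_cases hj : (j : ℕ) = 0
    · simp [hj]
    · rw [if_neg hj, ih]
      congr 2
      simp only [eq_iff_iff]
      omega

theorem aeval_jordanOp_jordanGen (v : Fin 3 → ℕ) (i : Fin 3) (f : ℂ[X]) (i' : Fin 3)
    (j : Fin (v i' + 1)) :
    (aeval (jordanOp v) f (jordanGen v i)) i' j = if i' = i then f.coeff j else 0 := by
  induction f using Polynomial.induction_on' with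
  | add p q hp hq =>
    rw [map_add, LinearMap.add_apply, Pi.add_apply, Pi.add_apply, hp, hq]
    split_ifs <;> simp
  | monomial n t =>
    rw [aeval_monomial, Module.End.mul_apply, Module.algebraMap_end_apply, Pi.smul_apply,
      Pi.smul_apply, jordanOp_pow_jordanGen, coeff_monomial]
    by_cases h1 : i' = i <;> by_cases h2 : n = (j : ℕ) <;> simp [h1, h2, eq_comm]

theorem isJordanBasis_jordanGen (v : Fin 3 → ℕ) :
    IsJordanBasis (fun i => v i + 1)
      (fun i => Module.AEval'.of (jordanOp v) (jordanGen v i)) := by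
  have key : ∀ f : Fin 3 → ℂ[X], ∑ i, f i • Module.AEval'.of (jordanOp v) (jordanGen v i)
      = Module.AEval'.of (jordanOp v) (fun i j => (f i).coeff j) := fun f => by
    have : ∀ i, f i • Module.AEval'.of (jordanOp v) (jordanGen v i)
        = Module.AEval'.of (jordanOp v) (aeval (jordanOp v) (f i) (jordanGen v i)) := fun i =>
      (Module.AEval.of_aeval_smul (jordanOp v) (f i) (jordanGen v i)).symm
    simp only [this, ← map_sum]
    congr 1
    funext i j
    rw [Finset.sum_apply, Finset.sum_apply]
    simp [aeval_jordanOp_jordanGen]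
  refine ⟨fun x => ?_, fun f => ?_⟩
  · refine ⟨fun i => ∑ j : Fin (v i + 1),
      monomial (j : ℕ) ((Module.AEval'.of (jordanOp v)).symm x i j), ?_⟩
    rw [key, ← LinearEquiv.symm_apply_eq]
    funext i j
    rw [finsetSum_coeff, Finset.sum_eq_single j]
    · simp
    · intro k _ hk
      rw [coeff_monomial, if_neg fun h => hk (Fin.ext h)]
    · simp
  · rw [key, LinearEquiv.map_eq_zero_iff]
    simp only [X_pow_dvd_iff]
    constructor
    · intro h i d hd
      exact congrFun (congrFun h i) ⟨d, hd⟩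
    · intro h
      funext i j
      exact h i j j.2

theorem isJordanTriple_jordanGen (v : Fin 3 → ℕ) :
    IsJordanTriple (v 0 + 1) (v 1 + 1) (v 2 + 1) (Module.AEval'.of (jordanOp v) (jordanGen v 0))
      (Module.AEval'.of (jordanOp v) (jordanGen v 1))
      (Module.AEval'.of (jordanOp v) (jordanGen v 2)) := by
  rw [← isJordanBasis_fin_three]
  convert isJordanBasis_jordanGen v using 1
  · funext i; fin_cases i <;> rfl
  · funext i; fin_cases i <;> rfl

theorem jordanTriple_hasForm (v : Fin 3 → ℕ)
    (y z : (JordanSpace v →ₗ[ℂ] JordanSpace v) → (Fin 3 → JordanSpace v) → JordanSpace v)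
    (k : Fin 8) (hlen : chainLengths k = (v 0 + 1, v 1 + 1, v 2 + 1))
    (hgens : formGens (Module.AEval'.of (jordanOp v) (jordanGen v 0))
      (Module.AEval'.of (jordanOp v) (jordanGen v 1))
      (Module.AEval'.of (jordanOp v) (jordanGen v 2)) k
        = (Module.AEval'.of (jordanOp v) (y (jordanOp v) (jordanGen v)),
          Module.AEval'.of (jordanOp v) (z (jordanOp v) (jordanGen v)))) {A : InvTriple}
    (hA : A = jordanTriple v fun T a => {y T a, z T a}) :
    HasForm k A.polySub := by
  subst hA
  have hspan : Submodule.span ℂ[X] {Module.AEval'.of (jordanOp v) (y (jordanOp v) (jordanGen v)),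
      Module.AEval'.of (jordanOp v) (z (jordanOp v) (jordanGen v))}
      = Submodule.span ℂ[X] 
        {(Module.AEval'.of (jordanOp v) (y (jordanOp v) (jordanGen v)),
          Module.AEval'.of (jordanOp v) (z (jordanOp v) (jordanGen v))).1,
        (Module.AEval'.of (jordanOp v) (y (jordanOp v) (jordanGen v)),
          Module.AEval'.of (jordanOp v) (z (jordanOp v) (jordanGen v))).2} := rfl
  rw [← hgens] at hspan
  refine ⟨Module.AEval'.of (jordanOp v) (jordanGen v 0),
    Module.AEval'.of (jordanOp v) (jordanGen v 1), Module.AEval'.of (jordanOp v) (jordanGen v 2),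
    ?_, (polySubmodule_vectT _).trans ((congrArg _ (Set.image_pair _ _ _)).trans hspan)⟩
  rw [hlen]
  exact isJordanTriple_jordanGen v

theorem indecList_hasForm (k : Fin 8) : HasForm k (indecList k).polySub := by
  have hX : ∀ (v : Fin 3 → ℕ) (n : ℕ) (x : JordanSpace v), Module.AEval'.of (jordanOp v)
      ((jordanOp v ^ n) x) = (X ^ n : ℂ[X]) • Module.AEval'.of (jordanOp v) x := fun v n x =>
    (Module.AEval'.X_pow_smul_of _ _ _).symm
  have hX1 : ∀ (v : Fin 3 → ℕ) (x : JordanSpace v), Module.AEval'.of (jordanOp v)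
      (jordanOp v x) = (X : ℂ[X]) • Module.AEval'.of (jordanOp v) x := fun v x =>
    (Module.AEval'.X_smul_of _ _).symm
  match k with
  | 0 =>
    exact jordanTriple_hasForm ![0, 2, 4] (fun T a => (T ^ 2) (a 1))
      (fun T a => (T ^ 2) (a 2) + T (a 1) + a 0)
      0 rfl (by simp only [map_add, hX, hX1]; rfl) rfl
  | 1 =>
    exact jordanTriple_hasForm ![1, 2, 4] (fun T a => T (a 1))
      (fun T a => T (a 2) + a 1 + a 0)
      1 rfl (by simp only [map_add, hX1]; rfl) rfl
  | 2 =>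
    exact jordanTriple_hasForm ![1, 2, 4] (fun T a => T (a 0))
      (fun T a => (T ^ 2) (a 2) + T (a 1) + a 0)
      2 rfl (by simp only [map_add, hX, hX1]; rfl) rfl
  | 3 =>
    exact jordanTriple_hasForm ![0, 2, 4] (fun T a => a 0 + T (a 1))
      (fun T a => (T ^ 2) (a 2) + a 0)
      3 rfl (by simp only [map_add, hX, hX1]; rfl) rfl
  | 4 =>
    exact jordanTriple_hasForm ![1, 3, 4] (fun T a => T (a 0) + (T ^ 2) (a 1))
      (fun T a => T (a 2) + a 0)
      4 rfl (by simp only [map_add, hX, hX1]; rfl) rfl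
  | 5 =>
    exact jordanTriple_hasForm ![1, 4, 4] (fun T a => T (a 0) + (T ^ 3) (a 1))
      (fun T a => T (a 2) + a 0)
      5 rfl (by simp only [map_add, hX, hX1]; rfl) rfl
  | 6 =>
    exact jordanTriple_hasForm ![1, 3, 4] (fun T a => a 0 + T (a 1))
      (fun T a => (T ^ 3) (a 2) + T (a 0))
      6 rfl (by simp only [map_add, hX, hX1]; rfl) rfl
  | 7 =>
    exact jordanTriple_hasForm ![0, 2, 4] (fun T a => a 0 + T (a 1))
      (fun T a => T (a 2) + a 1)
      7 rfl (by simp only [map_add, hX1]; rfl) rfl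

theorem map_formGens {N N' : Type*} [AddCommGroup N] [Module ℂ[X] N] [AddCommGroup N']
    [Module ℂ[X] N'] (φ : N →ₗ[ℂ[X]] N') (a b c : N) (k : Fin 8) :
    formGens (φ a) (φ b) (φ c) k = (φ (formGens a b c k).1, φ (formGens a b c k).2) := by
  fin_cases k <;> simp [formGens]

theorem InvTriple.similar_of_hasForm {A : InvTriple.{u}} {B : InvTriple.{v}} {k : Fin 8}
    (hA : HasForm k A.polySub) (hB : HasForm k B.polySub) : Similar A B := by
  obtain ⟨a, b, c, h, hU⟩ := hA
  obtain ⟨a', b', c', h', hU'⟩ := hB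
  obtain ⟨φ, hφ⟩ := (isJordanBasis_fin_three.2 h).exists_equiv (isJordanBasis_fin_three.2 h')
  have ha : φ a = a' := hφ 0
  have hb : φ b = b' := hφ 1
  have hc : φ c = c' := hφ 2
  refine similar_of_equiv φ ?_
  have hg := map_formGens φ.toLinearMap a b c k
  simp only [LinearEquiv.coe_coe, ha, hb, hc] at hg
  rw [hU, hU', Submodule.map_span, Set.image_pair, hg]
  rfl

/-! ### Generators and endomorphisms of the normal forms -/

/-- The lengths of the two Jordan chains generated by the generators of the normal forms. -/
def genLengths : Fin 8 → ℕ × ℕ :=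
  ![(1, 3), (2, 4), (1, 3), (2, 3), (2, 4), (2, 4), (3, 2), (2, 4)]

/-- The coordinates with respect to the Jordan basis of the combination of the two generators with
coefficients `f` and `g`. -/
noncomputable def formCoeffs (f g : ℂ[X]) : Fin 8 → ℂ[X] × ℂ[X] × ℂ[X] :=
  ![(g, X ^ 2 * f + X ^ 1 * g, X ^ 2 * g), (g, X ^ 1 * f + g, X ^ 1 * g),
    (X ^ 1 * f + g, X ^ 1 * g, X ^ 2 * g), (f + g, X ^ 1 * f, X ^ 2 * g),
    (X ^ 1 * f + g, X ^ 2 * f, X ^ 1 * g), (X ^ 1 * f + g, X ^ 3 * f, X ^ 1 * g),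
    (f + X ^ 1 * g, X ^ 1 * f, X ^ 3 * g), (f, X ^ 1 * f + g, X ^ 1 * g)]

section Coefficients

variable (f : ℂ[X])

theorem X_pow_one_dvd_iff : X ^ 1 ∣ f ↔ f.coeff 0 = 0 := by
  rw [pow_one, X_dvd_iff]

theorem X_pow_succ_dvd_iff (n : ℕ) : X ^ (n + 1) ∣ f ↔ X ^ n ∣ f ∧ f.coeff n = 0 := by
  rw [X_pow_dvd_iff, X_pow_dvd_iff, Nat.forall_lt_succ_right]

theorem X_pow_two_dvd_iff : X ^ 2 ∣ f ↔ f.coeff 0 = 0 ∧ f.coeff 1 = 0 := by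
  rw [X_pow_succ_dvd_iff, X_pow_one_dvd_iff]

theorem X_pow_three_dvd_iff :
    X ^ 3 ∣ f ↔ (f.coeff 0 = 0 ∧ f.coeff 1 = 0) ∧ f.coeff 2 = 0 := by
  rw [X_pow_succ_dvd_iff, X_pow_two_dvd_iff]

theorem X_pow_four_dvd_iff :
    X ^ 4 ∣ f ↔ ((f.coeff 0 = 0 ∧ f.coeff 1 = 0) ∧ f.coeff 2 = 0) ∧ f.coeff 3 = 0 := by
  rw [X_pow_succ_dvd_iff, X_pow_three_dvd_iff]

theorem X_pow_five_dvd_iff :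
    X ^ 5 ∣ f ↔ (((f.coeff 0 = 0 ∧ f.coeff 1 = 0) ∧ f.coeff 2 = 0) ∧ f.coeff 3 = 0) ∧
      f.coeff 4 = 0 := by
  rw [X_pow_succ_dvd_iff, X_pow_four_dvd_iff]

end Coefficients

section

variable {N : Type*} [AddCommGroup N] [Module ℂ[X] N]

theorem formGens_combination (a b c : N) (f g : ℂ[X]) (k : Fin 8) :
    f • (formGens a b c k).1 + g • (formGens a b c k).2
      = (formCoeffs f g k).1 • a + (formCoeffs f g k).2.1 • b + (formCoeffs f g k).2.2 • c := by
  fin_cases k <;>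
  · simp only [formGens, formCoeffs, Fin.zero_eta, Fin.mk_one, Fin.reduceFinMk, Matrix.cons_val]
    module

theorem formGens_relation {k : Fin 8} {a b c : N}
    (h : IsJordanTriple (chainLengths k).1 (chainLengths k).2.1 (chainLengths k).2.2 a b c)
    (f g : ℂ[X]) : f • (formGens a b c k).1 + g • (formGens a b c k).2 = 0 ↔
      X ^ (genLengths k).1 ∣ f ∧ X ^ (genLengths k).2 ∣ g := by
  rw [formGens_combination, h.relation]
  clear h
  fin_cases k <;>
  · simp only [chainLengths, genLengths, formCoeffs, Fin.zero_eta, Fin.mk_one, Fin.reduceFinMk,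
      Matrix.cons_val, X_pow_one_dvd_iff, X_pow_two_dvd_iff, X_pow_three_dvd_iff,
      X_pow_four_dvd_iff, X_pow_five_dvd_iff, coeff_add, coeff_X_pow_mul', Nat.reduceLeDiff,
      Nat.reduceSub, ↓reduceIte]
    grind

/-- The matrix, with respect to the Jordan basis, of an endomorphism that preserves the submodule
of a normal form has constant diagonal modulo `X`, and the first row vanishes modulo `X` off the
diagonal. -/
theorem exists_matrix {k : Fin 8} {a b c : N}
    (h : IsJordanTriple (chainLengths k).1 (chainLengths k).2.1 (chainLengths k).2.2 a b c)
    (E : N →ₗ[ℂ[X]] N) (hE : ∀ x ∈ Submodule.span ℂ[X] {(formGens a b c k).1, (formGens a b c k).2},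
      E x ∈ Submodule.span ℂ[X] {(formGens a b c k).1, (formGens a b c k).2}) :
    ∃ p₁ p₂ p₃ q₁ q₂ q₃ r₁ r₂ r₃ : ℂ[X], E a = p₁ • a + p₂ • b + p₃ • c ∧
      E b = q₁ • a + q₂ • b + q₃ • c ∧ E c = r₁ • a + r₂ • b + r₃ • c ∧
      p₂.coeff 0 = 0 ∧ p₃.coeff 0 = 0 ∧ q₂.coeff 0 = p₁.coeff 0 ∧ r₃.coeff 0 = p₁.coeff 0 := by
  obtain ⟨p₁, p₂, p₃, hp⟩ := h.generate (E a)
  obtain ⟨q₁, q₂, q₃, hq⟩ := h.generate (E b)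
  obtain ⟨r₁, r₂, r₃, hr⟩ := h.generate (E c)
  refine ⟨p₁, p₂, p₃, q₁, q₂, q₃, r₁, r₂, r₃, hp, hq, hr, ?_⟩
  have ha := congrArg E h.pow_smul
  have hb := congrArg E h.swap₁₂.pow_smul
  rw [map_smul, map_zero, hp] at ha
  rw [map_smul, map_zero, hq] at hb
  obtain ⟨-, ha₂, ha₃⟩ := (h.relation (X ^ (chainLengths k).1 * p₁) (X ^ (chainLengths k).1 * p₂)
    (X ^ (chainLengths k).1 * p₃)).1 (by rw [← ha]; module)
  obtain ⟨-, -, hb₃⟩ := (h.relation (X ^ (chainLengths k).2.1 * q₁) (X ^ (chainLengths k).2.1 * q₂)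
    (X ^ (chainLengths k).2.1 * q₃)).1 (by rw [← hb]; module)
  have himage : ∀ f g : ℂ[X], ∃ s t : ℂ[X],
      X ^ (chainLengths k).1 ∣ (formCoeffs f g k).1 * p₁ + (formCoeffs f g k).2.1 * q₁ +
        (formCoeffs f g k).2.2 * r₁ - (formCoeffs s t k).1 ∧
      X ^ (chainLengths k).2.1 ∣ (formCoeffs f g k).1 * p₂ + (formCoeffs f g k).2.1 * q₂ +
        (formCoeffs f g k).2.2 * r₂ - (formCoeffs s t k).2.1 ∧
      X ^ (chainLengths k).2.2 ∣ (formCoeffs f g k).1 * p₃ + (formCoeffs f g k).2.1 * q₃ +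
        (formCoeffs f g k).2.2 * r₃ - (formCoeffs s t k).2.2 := fun f g => by
    have h1 := hE _ (Submodule.mem_span_pair.2 ⟨f, g, rfl⟩)
    obtain ⟨s, t, hst⟩ := Submodule.mem_span_pair.1 h1
    refine ⟨s, t, (h.relation _ _ _).1 ?_⟩
    rw [formGens_combination, formGens_combination, map_add, map_add, map_smul, map_smul, map_smul,
      hp, hq, hr] at hst
    linear_combination (norm := module) -hst
  obtain ⟨s, t, hy₁, hy₂, hy₃⟩ := himage 1 0
  obtain ⟨s', t', hz₁, hz₂, hz₃⟩ := himage 0 1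
  clear himage hb ha hp hq hr hE h
  fin_cases k <;>
  · simp only [chainLengths, formCoeffs, Fin.zero_eta, Fin.mk_one, Fin.reduceFinMk,
      Matrix.cons_val, mul_one, mul_zero, zero_mul, one_mul, add_zero, zero_add,
      X_pow_one_dvd_iff, X_pow_two_dvd_iff, X_pow_three_dvd_iff,
      X_pow_four_dvd_iff, X_pow_five_dvd_iff, coeff_add, coeff_sub, coeff_X_pow_mul',
      Nat.reduceLeDiff, Nat.reduceSub, ↓reduceIte] at *
    grind

end

/-! ### Idempotent endomorphisms and invariants -/

section

variable {N : Type*} [AddCommGroup N] [Module ℂ[X] N]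

namespace IsJordanTriple

variable {μ ν σ : ℕ} {a b c : N}

/-- An idempotent endomorphism with image in `X N` vanishes, since `X` acts nilpotently. -/
theorem idempotent_eq_zero (h : IsJordanTriple μ ν σ a b c) (h5 : ∀ x : N, (X ^ 5 : ℂ[X]) • x = 0)
    (E : N →ₗ[ℂ[X]] N) (hE : ∀ x, E (E x) = E x) (ha : ∃ x : N, E a = (X : ℂ[X]) • x)
    (hb : ∃ x : N, E b = (X : ℂ[X]) • x) (hc : ∃ x : N, E c = (X : ℂ[X]) • x) (x : N) :
    E x = 0 := by
  obtain ⟨a', ha⟩ := ha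
  obtain ⟨b', hb⟩ := hb
  obtain ⟨c', hc⟩ := hc
  have hX : ∀ x, ∃ y : N, E x = (X : ℂ[X]) • y := fun x => by
    obtain ⟨f, g, k, rfl⟩ := h.generate x
    refine ⟨f • a' + g • b' + k • c', ?_⟩
    rw [map_add, map_add, map_smul, map_smul, map_smul, ha, hb, hc]
    module
  have hXn : ∀ n : ℕ, ∃ y : N, E x = (X ^ n : ℂ[X]) • y := fun n => by
    induction n with
    | zero => exact ⟨E x, by simp⟩
    | succ n ih =>
      obtain ⟨y, hy⟩ := ih
      obtain ⟨z, hz⟩ := hX y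
      refine ⟨z, ?_⟩
      rw [← hE, hy, map_smul, hz]
      module
  obtain ⟨y, hy⟩ := hXn 5
  rw [hy, h5]

theorem exists_eq_X_smul {p q r : ℂ[X]} (hp : p.coeff 0 = 0) (hq : q.coeff 0 = 0)
    (hr : r.coeff 0 = 0) (a b c : N) : ∃ x : N, p • a + q • b + r • c = (X : ℂ[X]) • x := by
  obtain ⟨p, rfl⟩ := X_dvd_iff.2 hp
  obtain ⟨q, rfl⟩ := X_dvd_iff.2 hq
  obtain ⟨r, rfl⟩ := X_dvd_iff.2 hr
  exact ⟨p • a + q • b + r • c, by module⟩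

/-- An idempotent endomorphism whose matrix modulo `X` has constant diagonal and vanishing
off-diagonal entries in the first row is trivial: its matrix modulo `X` is an idempotent with a
single eigenvalue, hence `0` or `1`. -/
theorem idempotent_trivial (h : IsJordanTriple μ ν σ a b c) (hμ : 0 < μ) (hν : 0 < ν) (hσ : 0 < σ)
    (h5 : ∀ x : N, (X ^ 5 : ℂ[X]) • x = 0) (E : N →ₗ[ℂ[X]] N) (hE : ∀ x, E (E x) = E x)
    {p₁ p₂ p₃ q₁ q₂ q₃ r₁ r₂ r₃ : ℂ[X]} (ha : E a = p₁ • a + p₂ • b + p₃ • c)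
    (hb : E b = q₁ • a + q₂ • b + q₃ • c) (hc : E c = r₁ • a + r₂ • b + r₃ • c)
    (hp₂ : p₂.coeff 0 = 0) (hp₃ : p₃.coeff 0 = 0) (hq₂ : q₂.coeff 0 = p₁.coeff 0)
    (hr₃ : r₃.coeff 0 = p₁.coeff 0) : (∀ x, E x = 0) ∨ ∀ x, E x = x := by
  -- the entries of `E ^ 2 = E` modulo `X`
  have key : ∀ (x : N) (f g k : ℂ[X]), E x = f • a + g • b + k • c →
      (f * p₁ + g * q₁ + k * r₁ - f).coeff 0 = 0 ∧ (f * p₂ + g * q₂ + k * r₂ - g).coeff 0 = 0 ∧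
      (f * p₃ + g * q₃ + k * r₃ - k).coeff 0 = 0 := fun x f g k hx => by
    have h1 := hE x
    rw [hx, map_add, map_add, map_smul, map_smul, map_smul, ha, hb, hc] at h1
    obtain ⟨d₁, d₂, d₃⟩ := (h.relation (f * p₁ + g * q₁ + k * r₁ - f)
      (f * p₂ + g * q₂ + k * r₂ - g) (f * p₃ + g * q₃ + k * r₃ - k)).1
      (by linear_combination (norm := module) h1)
    exact ⟨X_dvd_iff.1 ((dvd_pow_self X hμ.ne').trans d₁),
      X_dvd_iff.1 ((dvd_pow_self X hν.ne').trans d₂),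
      X_dvd_iff.1 ((dvd_pow_self X hσ.ne').trans d₃)⟩
  obtain ⟨a₁, -, -⟩ := key a _ _ _ ha
  obtain ⟨b₁, -, b₃⟩ := key b _ _ _ hb
  obtain ⟨c₁, c₂, -⟩ := key c _ _ _ hc
  simp only [coeff_sub, coeff_add, mul_coeff_zero, hp₂, hp₃, hq₂, hr₃] at a₁ b₁ b₃ c₁ c₂
  have hp₁ : p₁.coeff 0 = 0 ∨ p₁.coeff 0 = 1 := by
    rcases eq_or_ne (p₁.coeff 0) 0 with h0 | h0
    · exact .inl h0
    · exact .inr (mul_right_cancel₀ h0 (by linear_combination a₁))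
  have hq₃ : q₃.coeff 0 = 0 := by
    rcases hp₁ with h0 | h0 <;> rw [h0] at b₃
    · linear_combination -b₃
    · linear_combination b₃
  have hr₂ : r₂.coeff 0 = 0 := by
    rcases hp₁ with h0 | h0 <;> rw [h0] at c₂
    · linear_combination -c₂
    · linear_combination c₂
  rw [hq₃] at b₁
  rw [hr₂] at c₁
  have hq₁ : q₁.coeff 0 = 0 := by
    rcases hp₁ with h0 | h0 <;> rw [h0] at b₁
    · linear_combination -b₁
    · linear_combination b₁
  have hr₁ : r₁.coeff 0 = 0 := by
    rcases hp₁ with h0 | h0 <;> rw [h0] at c₁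
    · linear_combination -c₁
    · linear_combination c₁
  rcases hp₁ with h0 | h1
  · rw [h0] at hq₂ hr₃
    exact .inl (h.idempotent_eq_zero h5 E hE (ha ▸ exists_eq_X_smul h0 hp₂ hp₃ a b c)
      (hb ▸ exists_eq_X_smul hq₁ hq₂ hq₃ a b c) (hc ▸ exists_eq_X_smul hr₁ hr₂ hr₃ a b c))
  · right
    intro x
    rw [h1] at hq₂ hr₃
    have := h.idempotent_eq_zero h5 (LinearMap.id - E) (fun x => by simp [hE])
      (by
        obtain ⟨y, hy⟩ := exists_eq_X_smul (p := 1 - p₁) (q := -p₂) (r := -p₃) (by simp [h1])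
          (by simp [hp₂]) (by simp [hp₃]) a b c
        refine ⟨y, hy ▸ ?_⟩
        rw [LinearMap.sub_apply, LinearMap.id_apply, ha]
        module)
      (by
        obtain ⟨y, hy⟩ := exists_eq_X_smul (p := -q₁) (q := 1 - q₂) (r := -q₃) (by simp [hq₁])
          (by simp [hq₂]) (by simp [hq₃]) a b c
        refine ⟨y, hy ▸ ?_⟩
        rw [LinearMap.sub_apply, LinearMap.id_apply, hb]
        module)
      (by
        obtain ⟨y, hy⟩ := exists_eq_X_smul (p := -r₁) (q := -r₂) (r := 1 - r₃) (by simp [hr₁])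
          (by simp [hr₂]) (by simp [hr₃]) a b c
        refine ⟨y, hy ▸ ?_⟩
        rw [LinearMap.sub_apply, LinearMap.id_apply, hc]
        module) x
    rw [LinearMap.sub_apply, LinearMap.id_apply, sub_eq_zero] at this
    exact this.symm

end IsJordanTriple

theorem chainLengths_bounds (k : Fin 8) : (0 < (chainLengths k).1 ∧ (chainLengths k).1 ≤ 5) ∧
    (0 < (chainLengths k).2.1 ∧ (chainLengths k).2.1 ≤ 5) ∧ (chainLengths k).2.2 = 5 := by
  decide +revert

theorem IsJordanTriple.pow_five_smul {μ ν σ : ℕ} {a b c : N} (h : IsJordanTriple μ ν σ a b c)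
    (hμ : μ ≤ 5) (hν : ν ≤ 5) (hσ : σ ≤ 5) (x : N) : (X ^ 5 : ℂ[X]) • x = 0 := by
  obtain ⟨f, g, k, rfl⟩ := h.generate x
  rw [smul_add, smul_add, smul_smul, smul_smul, smul_smul, h.relation]
  exact ⟨Dvd.dvd.mul_right (pow_dvd_pow X hμ) f, Dvd.dvd.mul_right (pow_dvd_pow X hν) g,
    Dvd.dvd.mul_right (pow_dvd_pow X hσ) k⟩

theorem isJordanBasis_span_pair {y z : N} {m n : ℕ}
    (h : ∀ f g : ℂ[X], f • y + g • z = 0 ↔ X ^ m ∣ f ∧ X ^ n ∣ g) :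
    IsJordanBasis (N := Submodule.span ℂ[X] {y, z}) ![m, n]
      ![⟨y, Submodule.subset_span (by simp)⟩, ⟨z, Submodule.subset_span (by simp)⟩] := by
  refine ⟨fun x => ?_, fun f => ?_⟩
  · obtain ⟨f, g, hfg⟩ := Submodule.mem_span_pair.1 x.2
    exact ⟨![f, g], Subtype.ext (by simp [hfg])⟩
  · rw [Fin.sum_univ_two, Subtype.ext_iff]
    simpa [Fin.forall_fin_succ] using h (f 0) (f 1)

end

section

open InvTriple

variable {A : InvTriple.{u}} {k : Fin 8}

theorem HasForm.indecomposable (hA : HasForm k A.polySub) : A.Indecomposable := by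
  obtain ⟨a, b, c, h, hU⟩ := hA
  obtain ⟨⟨hμ, hμ5⟩, ⟨hν, hν5⟩, hσ⟩ := chainLengths_bounds k
  refine indecomposable_of_idempotents fun E hE hEU => ?_
  rw [hU] at hEU
  obtain ⟨p₁, p₂, p₃, q₁, q₂, q₃, r₁, r₂, r₃, ha, hb, hc, h1, h2, h3, h4⟩ := exists_matrix h E hEU
  exact h.idempotent_trivial hμ hν (by omega) (h.pow_five_smul hμ5 hν5 hσ.le) E hE ha hb hc h1 h2
    h3 h4

theorem HasForm.nilpotentOfOrder (hA : HasForm k A.polySub) : A.NilpotentOfOrder 5 := by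
  obtain ⟨a, b, c, h, -⟩ := hA
  obtain ⟨⟨-, hμ5⟩, ⟨-, hν5⟩, hσ⟩ := chainLengths_bounds k
  have hpow : ∀ (n : ℕ) (x : A.V),
      Module.AEval'.of A.T ((A.T ^ n) x) = (X ^ n : ℂ[X]) • Module.AEval'.of A.T x := fun n x =>
    (Module.AEval'.X_pow_smul_of _ _ _).symm
  refine ⟨by norm_num, ?_, fun h0 => ?_⟩
  · ext x
    apply (Module.AEval'.of A.T).injective
    rw [hpow, h.pow_five_smul hμ5 hν5 hσ.le]
    rfl
  · have h1 := hpow 4 ((Module.AEval'.of A.T).symm c)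
    rw [LinearEquiv.apply_symm_apply, show A.T ^ 4 = 0 from h0, LinearMap.zero_apply,
      map_zero] at h1
    have h2 := (h.swap₁₃.smul_eq_zero_iff _).1 h1.symm
    rw [hσ, pow_dvd_pow_iff X_ne_zero not_isUnit_X] at h2
    omega

theorem HasForm.nV_eq (hA : HasForm k A.polySub) : A.nV = 3 := by
  obtain ⟨a, b, c, h, -⟩ := hA
  obtain ⟨⟨hμ, -⟩, ⟨hν, -⟩, hσ⟩ := chainLengths_bounds k
  rw [A.nV_eq, (isJordanBasis_fin_three.2 h).finrank_torsionBy_X, Fintype.card_fin]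
  intro i
  fin_cases i
  exacts [hμ, hν, by simp [hσ]]

theorem HasForm.nU_eq (hA : HasForm k A.polySub) : A.nU = 2 := by
  obtain ⟨a, b, c, h, hU⟩ := hA
  rw [A.nU_eq, hU,
    (isJordanBasis_span_pair (formGens_relation h)).finrank_torsionBy_X, Fintype.card_fin]
  clear h hU
  revert k
  decide

theorem HasForm.finrank_V (hA : HasForm k A.polySub) : Module.finrank ℂ A.V
    = (chainLengths k).1 + (chainLengths k).2.1 + (chainLengths k).2.2 := by
  obtain ⟨a, b, c, h, -⟩ := hA
  rw [(Module.AEval'.of A.T).finrank_eq, (isJordanBasis_fin_three.2 h).finrank_eq_sum,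
    Fin.sum_univ_three]
  rfl

theorem HasForm.finrank_U (hA : HasForm k A.polySub) :
    Module.finrank ℂ A.U = (genLengths k).1 + (genLengths k).2 := by
  obtain ⟨a, b, c, h, hU⟩ := hA
  rw [finrank_U_eq, hU, (isJordanBasis_span_pair (formGens_relation h)).finrank_eq_sum,
    Fin.sum_univ_two]
  rfl

end

/-! ### The classification -/

theorem IsJordanTriple.map_equiv {N N' : Type*} [AddCommGroup N] [Module ℂ[X] N] [AddCommGroup N']
    [Module ℂ[X] N'] {μ ν σ : ℕ} {a b c : N} (h : IsJordanTriple μ ν σ a b c)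
    (φ : N ≃ₗ[ℂ[X]] N') : IsJordanTriple μ ν σ (φ a) (φ b) (φ c) where
  generate x := by
    obtain ⟨f, g, k, hx⟩ := h.generate (φ.symm x)
    refine ⟨f, g, k, ?_⟩
    rw [← φ.apply_symm_apply x, hx, map_add, map_add, map_smul, map_smul, map_smul]
  relation f g k := by
    rw [← h.relation, ← φ.map_eq_zero_iff, map_add, map_add, map_smul, map_smul, map_smul]

/-- A module whose Jordan basis consists of two nonzero chains is not cyclic. -/
theorem IsJordanBasis.span_singleton_ne {N : Type*} [AddCommGroup N] [Module ℂ[X] N]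
    {U : Submodule ℂ[X] N} {m : Fin 2 → ℕ} {e : Fin 2 → U} (h : IsJordanBasis m e)
    (hm : ∀ i, 0 < m i) (x : N) : U ≠ Submodule.span ℂ[X] {x} := by
  intro hU
  have hx : x ∈ U := hU ▸ Submodule.mem_span_singleton_self x
  have hmul : ∀ y : U, ∃ f : ℂ[X], y = f • (⟨x, hx⟩ : U) := fun y => by
    have hy : y.1 ∈ Submodule.span ℂ[X] {x} := by rw [← hU]; exact y.2
    obtain ⟨f, hf⟩ := Submodule.mem_span_singleton.1 hy
    exact ⟨f, Subtype.ext hf.symm⟩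
  obtain ⟨f, hf⟩ := hmul (e 0)
  obtain ⟨g, hg⟩ := hmul (e 1)
  obtain ⟨p, hp⟩ := h.generate ⟨x, hx⟩
  rw [Fin.sum_univ_two] at hp
  rw [hp] at hf hg
  have h1 := (h.relation ![f * p 0 - 1, f * p 1]).1 (by
    rw [Fin.sum_univ_two]
    simp only [Matrix.cons_val]
    linear_combination (norm := module) -hf)
  have h2 := (h.relation ![g * p 0, g * p 1 - 1]).1 (by
    rw [Fin.sum_univ_two]
    simp only [Matrix.cons_val]
    linear_combination (norm := module) -hg)
  have hX : ∀ (i : Fin 2) (q : ℂ[X]), X ^ m i ∣ q → q.coeff 0 = 0 := fun i q hq =>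
    X_dvd_iff.1 ((dvd_pow_self X (hm i).ne').trans hq)
  have h3 := hX 0 _ (h1 0)
  have h4 := hX 1 _ (h1 1)
  have h5 := hX 1 _ (h2 1)
  simp only [Matrix.cons_val, coeff_sub, mul_coeff_zero, coeff_one_zero] at h3 h4 h5
  grind

namespace InvTriple

theorem exists_equiv_of_similar {A : InvTriple.{u}} {B : InvTriple.{v}} (h : Similar A B) :
    ∃ φ : Module.AEval' A.T ≃ₗ[ℂ[X]] Module.AEval' B.T,
      A.polySub.map φ.toLinearMap = B.polySub := by
  obtain ⟨f, hU, hT⟩ := h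
  refine ⟨LinearEquiv.ofAEval A.T (f ≪≫ₗ Module.AEval'.of B.T) fun x => ?_, ?_⟩
  · rw [LinearEquiv.trans_apply, LinearEquiv.trans_apply, Module.AEval'.X_smul_of, ← hT]
    rfl
  · ext y
    rw [mem_polySubmodule]
    rw [← hU]
    constructor
    · rintro ⟨x, hx, rfl⟩
      exact ⟨_, mem_polySubmodule.1 hx, rfl⟩
    · rintro ⟨x, hx, hxy⟩
      exact ⟨Module.AEval'.of A.T x, of_mem_polySubmodule.2 hx,
        (LinearEquiv.symm_apply_eq _).1 hxy.symm ▸ rfl⟩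

theorem hasForm_of_similar {A : InvTriple.{u}} {B : InvTriple.{v}} {k : Fin 8} (h : Similar A B)
    (hA : HasForm k A.polySub) : HasForm k B.polySub := by
  obtain ⟨φ, hφ⟩ := exists_equiv_of_similar h
  obtain ⟨a, b, c, habc, hU⟩ := hA
  refine ⟨φ a, φ b, φ c, habc.map_equiv φ, ?_⟩
  have hg := map_formGens φ.toLinearMap a b c k
  simp only [LinearEquiv.coe_coe] at hg
  rw [← hφ, hU, Submodule.map_span, Set.image_pair, hg]
  rfl

theorem eq_of_hasForm {A : InvTriple.{u}} {B : InvTriple.{v}} {k l : Fin 8} (h : Similar A B)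
    (hA : HasForm k A.polySub) (hB : HasForm l B.polySub) : k = l := by
  obtain ⟨f, hU, -⟩ := h
  have h1 := f.finrank_eq
  have h2 : Module.finrank ℂ A.U = Module.finrank ℂ B.U := by
    rw [← hU]
    exact (LinearEquiv.finrank_map_eq f A.U).symm
  rw [hA.finrank_V, hB.finrank_V] at h1
  rw [hA.finrank_U, hB.finrank_U] at h2
  clear hA hB
  revert k l
  decide

/-- Every indecomposable triple with `n_V = 3`, `n_U = 2` and nilpotency order at most five is in
one of the eight normal forms. -/
theorem exists_hasForm {A : InvTriple.{u}} {p : ℕ} (hp : p ≤ 5) (hT : A.NilpotentOfOrder p)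
    (hA : A.Indecomposable) (hV : A.nV = 3) (hU : A.nU = 2) : ∃ k, HasForm k A.polySub := by
  have h5 : ∀ x : Module.AEval' A.T, (X ^ 5 : ℂ[X]) • x = 0 := fun x => by
    have := Module.AEval'.X_pow_smul_of A.T ((Module.AEval'.of A.T).symm x) 5
    rw [LinearEquiv.apply_symm_apply, pow_eq_zero_of_le hp hT.2.1, zero_smul, map_zero] at this
    exact this
  rw [nV_eq] at hV
  rw [nU_eq] at hU
  obtain ⟨m, e, hm, he⟩ := exists_isJordanBasis h5 hV
  obtain ⟨m', e', hm', he'⟩ := exists_isJordanBasis (N := A.polySub) (n := 5)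
    (fun x => Subtype.ext (h5 x.1)) hU
  have h : IsJordanTriple (m 0) (m 1) (m 2) (e 0) (e 1) (e 2) := by
    rw [← isJordanBasis_fin_three]
    convert he using 1
    · funext i; fin_cases i <;> rfl
    · funext i; fin_cases i <;> rfl
  have hspan : A.polySub = Submodule.span ℂ[X] {(e' 0).1, (e' 1).1} := by
    apply le_antisymm
    · intro x hx
      obtain ⟨f, hf⟩ := he'.generate ⟨x, hx⟩
      rw [Fin.sum_univ_two, Subtype.ext_iff] at hf
      exact Submodule.mem_span_pair.2 ⟨f 0, f 1, hf.symm⟩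
    · rw [Submodule.span_le]
      rintro x (rfl | rfl)
      exacts [(e' 0).2, (e' 1).2]
  have hcyc := he'.span_singleton_ne hm'
  have hns : ¬ IsDecomposable A.polySub := fun hs => not_indecomposable_of_splits hs hA
  rw [hspan] at hcyc hns ⊢
  rcases h.splits_or_hasStringForm_or_hasTripodForm h5 (hm 0) (hm 1) (hm 2) hcyc with h1 | h1 | h1
  · exact absurd h1 hns
  · exact (h1.splits_or_hasForm h5).resolve_left hns
  · exact ⟨0, h1.hasForm⟩

theorem NilpotentOfOrder.unique {A : InvTriple.{u}} {p q : ℕ} (hp : A.NilpotentOfOrder p)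
    (hq : A.NilpotentOfOrder q) : p = q := by
  have key : ∀ {p q : ℕ}, A.NilpotentOfOrder p → A.NilpotentOfOrder q → p ≤ q := fun hp hq => by
    by_contra! hlt
    exact hp.2.2 (pow_eq_zero_of_le (by omega) hq.2.1)
  exact le_antisymm (key hp hq) (key hq hp)

/-- A copy of a triple in a larger universe. -/
noncomputable def lift (A : InvTriple.{0}) : InvTriple.{u} where
  V := ULift.{u} A.V
  T := (ULift.moduleEquiv (R := ℂ) (M := A.V)).symm.conj A.T
  U := A.U.comap (ULift.moduleEquiv (R := ℂ) (M := A.V)).toLinearMap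
  invariant _ hx := A.invariant _ hx

theorem similar_lift (A : InvTriple.{0}) : Similar A (lift.{u} A) := by
  refine ⟨(ULift.moduleEquiv (R := ℂ) (M := A.V)).symm, ?_, fun _ => rfl⟩
  exact Submodule.map_equiv_eq_comap_symm _ _

end InvTriple

theorem mainTheorem4 :
    (∀ (p : ℕ) (A : InvTriple.{u}), p ≤ 5 → A.NilpotentOfOrder p → A.Indecomposable →
      A.nV = 3 → A.nU = 2 → p = 5) ∧
    (∀ p : ℕ, p ≤ 4 → ¬ ∃ A : InvTriple.{u},
      A.NilpotentOfOrder p ∧ A.Indecomposable ∧ A.nV = 3 ∧ A.nU = 2) ∧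
    Nat.card (Quotient (InvTriple.indecSetoid.{u} 5 3 2)) = 8 ∧
    (∀ k : Fin 8, (indecList k).NilpotentOfOrder 5 ∧ (indecList k).Indecomposable ∧
      (indecList k).nV = 3 ∧ (indecList k).nU = 2) ∧
    (∀ k l : Fin 8, InvTriple.Similar (indecList k) (indecList l) → k = l) ∧
    (∀ A : InvTriple.{u}, A.NilpotentOfOrder 5 → A.Indecomposable → A.nV = 3 → A.nU = 2 →
      ∃! k : Fin 8, InvTriple.Similar A (indecList k)) := by
  have horder : ∀ (p : ℕ) (A : InvTriple.{u}), p ≤ 5 → A.NilpotentOfOrder p → A.Indecomposable →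
      A.nV = 3 → A.nU = 2 → p = 5 := fun p A hp hT hA hV hU => by
    obtain ⟨k, hk⟩ := InvTriple.exists_hasForm hp hT hA hV hU
    exact hT.unique hk.nilpotentOfOrder
  have hinj : ∀ k l : Fin 8, InvTriple.Similar (indecList k) (indecList l) → k = l := fun k l h =>
    InvTriple.eq_of_hasForm h (indecList_hasForm k) (indecList_hasForm l)
  have hclass : ∀ A : InvTriple.{u}, A.NilpotentOfOrder 5 → A.Indecomposable → A.nV = 3 →
      A.nU = 2 → ∃! k : Fin 8, InvTriple.Similar A (indecList k) := fun A hT hA hV hU => by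
    obtain ⟨k, hk⟩ := InvTriple.exists_hasForm le_rfl hT hA hV hU
    exact ⟨k, InvTriple.similar_of_hasForm hk (indecList_hasForm k),
      fun l hl => InvTriple.eq_of_hasForm hl.symm (indecList_hasForm l) hk⟩
  refine ⟨horder, ?_, ?_, fun k => ?_, hinj, hclass⟩
  · rintro p hp ⟨A, hT, hA, hV, hU⟩
    have := horder p A (by omega) hT hA hV hU
    omega
  · have hlift : ∀ k, HasForm k (InvTriple.lift.{u} (indecList k)).polySub := fun k =>
      InvTriple.hasForm_of_similar (InvTriple.similar_lift _) (indecList_hasForm k)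
    let rep : Fin 8 → InvTriple.Indec.{u} 5 3 2 := fun k =>
      ⟨InvTriple.lift (indecList k), (hlift k).nilpotentOfOrder,
      (hlift k).indecomposable, (hlift k).nV_eq, (hlift k).nU_eq⟩
    have hbij : Function.Bijective
        (fun k => Quotient.mk (InvTriple.indecSetoid.{u} 5 3 2) (rep k)) := by
      constructor
      · intro k l hkl
        exact InvTriple.eq_of_hasForm (Quotient.exact hkl) (hlift k) (hlift l)
      · intro q
        obtain ⟨⟨A, hT, hA, hV, hU⟩, rfl⟩ := Quotient.exists_rep q
        obtain ⟨k, hk, -⟩ := hclass A hT hA hV hU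
        exact ⟨k, Quotient.sound (hk.trans (InvTriple.similar_lift _)).symm⟩
    rw [← Nat.card_eq_of_bijective _ hbij, Nat.card_fin]
  · have h := indecList_hasForm k
    exact ⟨h.nilpotentOfOrder, h.indecomposable, h.nV_eq, h.nU_eq⟩
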